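/- Conventions. A groupoid $G$ is a set of arrows with unit space $G^{(0)}\subset G$, range and source maps $r,s\colon G\to G^{(0)}$, an associative product $gh$ defined when $s(g)=r(h)$, and inverses. All groupoids are topological groupoids that are locally compact, Hausdorff and étale ($r$ and $s$ are local homeomorphisms onto $G^{(0)}$), with compact (possibly non-metrizable) unit space. For $x\in G^{(0)}$ put $Gx=\{g\in G: s(g)=x\}$. A groupoid $G$ is minimal if the only open sets $U\subset G^{(0)}$ with $r(s^{-1}(U))=U$ are $\emptyset$ and $G^{(0)}$; it is essentially principal if $\{g\in G\setminus G^{(0)}: r(g)=s(g)\}$ has empty interior in $G$. A quotient homomorphism from $G$ onto $H$ is a map $\pi\colon G\to H$ that is a topological quotient map (so continuous and surjective) and a groupoid homomorphism: if $s(g)=r(h)$, then $s(\pi(g))=r(\pi(h))$ and $\pi(gh)=\pi(g)\pi(h)$. The reduced groupoid C$^*$-algebra $C^*_r(G)$ is the C$^*$-algebra of operators on $\ell^2(G)=\bigoplus_{x\in G^{(0)}}\ell^2(Gx)$ generated by the operators $\lambda(f)$, $f\in C_c(G)$, where $(\lambda(f)\xi)(g)=\sum_{h\in G,\ s(h)=s(g)}f(gh^{-1})\xi(h)$.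 A unital C$^*$-algebra $A$ is called purely infinite here if it is simple (non-zero, with no closed two-sided ideals other than $0$ and $A$) and for every non-zero positive $a\in A$ there is $x\in A$ with $xax^*=1$. Theorem. Let $G$ be a minimal groupoid which admits a quotient homomorphism $\pi$ from $G$ onto an essentially principal groupoid $H$ such that (1) $\pi$ is proper; (2) for each $x\in G^{(0)}$, the restriction $\pi|_{Gx}\colon Gx\to H\pi(x)$ is bijective; (3) the reduced groupoid C$^*$-algebra $C^*_r(H)$ is purely infinite. Then the reduced groupoid C$^*$-algebra $C^*_r(G)$ is purely infinite. -/

import Mathlib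

open Topology
open scoped ENNReal CompactlySupported

/-- A groupoid, as a set `G` of arrows with a distinguished set of units. The product `mul g h`
is the groupoid product when `s g = r h`; nothing is assumed about it, and it is never used,
for a pair that is not composable. -/
class ArrowGroupoid (G : Type*) where
  /-- the unit space `G⁽⁰⁾` -/
  unitSpace : Set G
  /-- the range map -/
  r : G → unitSpace
  /-- the source map -/
  s : G → unitSpace
  /-- the product of a composable pair -/
  mul : G → G → G
  /-- the inverse -/
  inv : G → G
  r_unit : ∀ x : unitSpace, r x = x
  s_unit : ∀ x : unitSpace, s x = x
  r_mul : ∀ g h : G, s g = r h → r (mul g h) = r g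
  s_mul : ∀ g h : G, s g = r h → s (mul g h) = s h
  unit_mul : ∀ g : G, mul (r g) g = g
  mul_unit : ∀ g : G, mul g (s g) = g
  assoc : ∀ g₁ g₂ g₃ : G, s g₁ = r g₂ → s g₂ = r g₃ →
    mul (mul g₁ g₂) g₃ = mul g₁ (mul g₂ g₃)
  r_inv : ∀ g : G, r (inv g) = s g
  s_inv : ∀ g : G, s (inv g) = r g
  mul_inv : ∀ g : G, mul g (inv g) = r g
  inv_mul : ∀ g : G, mul (inv g) g = s g

/-- An étale groupoid: a topological groupoid (all operations are continuous) whose range and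
source maps are local homeomorphisms onto the unit space, which carries the subspace topology. -/
class EtaleGroupoid (G : Type*) [TopologicalSpace G] extends ArrowGroupoid G where
  continuousOn_mul :
    ContinuousOn (fun p : G × G => mul p.1 p.2) {p : G × G | s p.1 = r p.2}
  continuous_inv : Continuous inv
  isLocalHomeomorph_r : IsLocalHomeomorph r
  isLocalHomeomorph_s : IsLocalHomeomorph s

namespace EtaleGroupoid

open ArrowGroupoid

section Algebra

variable {G : Type*} [ArrowGroupoid G]

theorem inv_mul_cancel_left {g x : G} (h : s g = r x) : mul (inv g) (mul g x) = x := by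
  rw [← assoc _ _ _ (s_inv g) h, inv_mul, h, unit_mul]

theorem inv_inv (g : G) : inv (inv g) = g := by
  have h1 : mul (mul (inv (inv g)) (inv g)) g = mul (inv (inv g)) (mul (inv g) g) :=
    assoc _ _ _ (s_inv _) (s_inv g)
  rw [inv_mul, inv_mul, s_inv, unit_mul] at h1
  have h2 : s (inv (inv g)) = s g := by rw [s_inv, r_inv]
  rw [← h2, mul_unit] at h1
  exact h1.symm

theorem mul_inv_cancel_right {g h : G} (e : s g = s h) : mul (mul g (inv h)) h = g := by
  rw [assoc _ _ _ (e.trans (r_inv h).symm) (s_inv h), inv_mul, ← e, mul_unit]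

end Algebra

section Operators

/-- A compact set meets the fibres of a locally injective map in uniformly boundedly many
points. -/
theorem exists_encard_fibre_le {X Y : Type*} [TopologicalSpace X] {p : X → Y}
    (hp : IsLocallyInjective p) {K : Set X} (hK : IsCompact K) :
    ∃ N : ℕ, ∀ y, (K ∩ p ⁻¹' {y}).encard ≤ N := by
  refine hK.induction_on (p := fun S => ∃ N : ℕ, ∀ y, (S ∩ p ⁻¹' {y}).encard ≤ N)
    ⟨0, by simp⟩ ?_ ?_ ?_
  · rintro S T hST ⟨N, hN⟩
    exact ⟨N, fun y => (Set.encard_le_encard (Set.inter_subset_inter_left _ hST)).trans (hN y)⟩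
  · rintro S T ⟨N, hN⟩ ⟨M, hM⟩
    refine ⟨N + M, fun y => ?_⟩
    rw [Set.union_inter_distrib_right]
    refine (Set.encard_union_le _ _).trans ?_
    push_cast
    exact add_le_add (hN y) (hM y)
  · intro x _
    obtain ⟨U, hU, hxU, hinj⟩ := hp x
    refine ⟨U, mem_nhdsWithin_of_mem_nhds (hU.mem_nhds hxU), 1, fun y => ?_⟩
    simp only [Nat.cast_one]
    rw [Set.encard_le_one_iff]
    rintro a b ⟨ha, ha'⟩ ⟨hb, hb'⟩
    exact hinj ha hb (ha'.trans hb'.symm)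

/-- A bounded matrix with boundedly many non-zero entries in each row and in each column satisfies
an `ℓ²`-bound. -/
theorem exists_sum_sq_le {ι : Type*} (k : ι → ι → ℂ) {M : ℝ} {N : ℕ}
    (hM : ∀ i j, ‖k i j‖ ≤ M) (hrow : ∀ i, {j | k i j ≠ 0}.encard ≤ N)
    (hcol : ∀ j, {i | k i j ≠ 0}.encard ≤ N) (ξ : lp (fun _ : ι => ℂ) 2) (F : Finset ι) :
    ∑ i ∈ F, ‖∑ᶠ j, k i j * ξ j‖ ^ 2 ≤ (N * M * ‖ξ‖) ^ 2 := by
  classical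
  have hfin : ∀ i, {j | k i j ≠ 0}.Finite := fun i =>
    Set.finite_of_encard_le_coe (hrow i)
  let R : ι → Finset ι := fun i => (hfin i).toFinset
  have hRmem : ∀ i j, j ∈ R i ↔ k i j ≠ 0 := fun i j => by simp [R]
  have hRcard : ∀ i, ((R i).card : ℝ) ≤ N := fun i => by
    have := hrow i
    rw [(hfin i).encard_eq_coe_toFinset_card] at this
    exact_mod_cast this
  have hξ : ∀ S : Finset ι, ∑ j ∈ S, ‖ξ j‖ ^ 2 ≤ ‖ξ‖ ^ 2 := fun S => by
    have := lp.sum_rpow_le_norm_rpow (p := 2) (by norm_num) ξ S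
    simpa using this
  have h1 : ∀ i, ‖∑ᶠ j, k i j * ξ j‖ ^ 2 ≤ N * M ^ 2 * ∑ j ∈ R i, ‖ξ j‖ ^ 2 := fun i => by
    rw [finsum_eq_sum_of_support_subset (s := R i)]
    · calc ‖∑ j ∈ R i, k i j * ξ j‖ ^ 2 ≤ (∑ j ∈ R i, ‖k i j * ξ j‖) ^ 2 := by
            gcongr; exact norm_sum_le _ _
        _ ≤ (R i).card * ∑ j ∈ R i, ‖k i j * ξ j‖ ^ 2 := sq_sum_le_card_mul_sum_sq
        _ ≤ N * ∑ j ∈ R i, M ^ 2 * ‖ξ j‖ ^ 2 := by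
            gcongr with j _
            · exact_mod_cast hRcard i
            · rw [norm_mul, mul_pow]
              gcongr
              exact hM i j
        _ = _ := by rw [← Finset.mul_sum]; ring
    · intro j hj
      simp only [Function.mem_support] at hj
      exact (hRmem i j).2 (left_ne_zero_of_mul hj)
  have h2 : ∑ i ∈ F, ∑ j ∈ R i, ‖ξ j‖ ^ 2 ≤ N * ‖ξ‖ ^ 2 := by
    have e : ∑ i ∈ F, ∑ j ∈ R i, ‖ξ j‖ ^ 2
        = ∑ j ∈ F.biUnion R, ∑ i ∈ F.filter (fun i => j ∈ R i), ‖ξ j‖ ^ 2 := by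
      apply Finset.sum_comm'
      intro i j
      simp only [Finset.mem_filter, Finset.mem_biUnion]
      exact ⟨fun h => ⟨h, i, h⟩, fun h => h.1⟩
    rw [e]
    calc _ ≤ ∑ j ∈ F.biUnion R, N * ‖ξ j‖ ^ 2 := by
          refine Finset.sum_le_sum fun j _ => ?_
          rw [Finset.sum_const, nsmul_eq_mul]
          gcongr
          have : ((F.filter (fun i => j ∈ R i) : Finset ι) : Set ι).encard ≤ N :=
            (Set.encard_le_encard (fun i hi => by
              simp only [Finset.coe_filter, Set.mem_ofPred_eq] at hi
              exact (hRmem i j).1 hi.2)).trans (hcol j)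
          rw [Set.encard_coe_eq_coe_finsetCard] at this
          exact_mod_cast this
      _ = N * ∑ j ∈ F.biUnion R, ‖ξ j‖ ^ 2 := by rw [Finset.mul_sum]
      _ ≤ _ := by gcongr; exact hξ _
  calc ∑ i ∈ F, ‖∑ᶠ j, k i j * ξ j‖ ^ 2
      ≤ ∑ i ∈ F, N * M ^ 2 * ∑ j ∈ R i, ‖ξ j‖ ^ 2 := Finset.sum_le_sum fun i _ => h1 i
    _ = N * M ^ 2 * ∑ i ∈ F, ∑ j ∈ R i, ‖ξ j‖ ^ 2 := by rw [← Finset.mul_sum]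
    _ ≤ N * M ^ 2 * (N * ‖ξ‖ ^ 2) := by gcongr
    _ = _ := by ring

variable {G : Type*} [TopologicalSpace G] [EtaleGroupoid G]

open Classical in
/-- The matrix of left convolution by `f`: its `(g, h)` entry is `f (g h⁻¹)` when `s g = s h`, and
`0` otherwise. -/
noncomputable def kernel (f : C_c(G, ℂ)) (g h : G) : ℂ :=
  if s g = s h then f (mul g (inv h)) else 0

theorem kernel_bounds (f : C_c(G, ℂ)) : ∃ (M : ℝ) (N : ℕ), 0 ≤ M ∧
    (∀ g h, ‖kernel f g h‖ ≤ M) ∧ (∀ g, {h | kernel f g h ≠ 0}.encard ≤ N) ∧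
    (∀ h, {g | kernel f g h ≠ 0}.encard ≤ N) := by
  obtain ⟨M, hM⟩ := f.continuous.bounded_above_of_compact_support f.hasCompactSupport
  have hK : IsCompact (tsupport f) := f.hasCompactSupport
  obtain ⟨N₁, h₁⟩ := exists_encard_fibre_le
    (isLocalHomeomorph_r (G := G)).isLocallyInjective hK
  obtain ⟨N₂, h₂⟩ := exists_encard_fibre_le
    (isLocalHomeomorph_s (G := G)).isLocallyInjective hK
  have hker : ∀ {g h : G}, kernel f g h ≠ 0 → s g = s h ∧ f (mul g (inv h)) ≠ 0 := by
    intro g h hgh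
    unfold kernel at hgh
    split_ifs at hgh with e
    · exact ⟨e, hgh⟩
    · exact absurd rfl hgh
  refine ⟨max M 0, N₁ + N₂, le_max_right _ _, fun g h => ?_, fun g => ?_, fun h => ?_⟩
  · unfold kernel
    split_ifs
    · exact (hM _).trans (le_max_left _ _)
    · simp
  · refine le_trans ?_ ((h₁ (r g)).trans (by push_cast; exact le_self_add))
    refine Set.encard_le_encard_of_injOn (f := fun h => mul g (inv h)) ?_ ?_
    · intro h hh
      obtain ⟨e, hf⟩ := hker hh
      exact ⟨subset_tsupport f hf, r_mul _ _ (e.trans (r_inv h).symm)⟩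
    · intro h hh h' hh' heq
      have e := (hker hh).1.trans (r_inv h).symm
      have e' := (hker hh').1.trans (r_inv h').symm
      have := congrArg (mul (inv g)) heq
      simp only [inv_mul_cancel_left e, inv_mul_cancel_left e'] at this
      rw [← inv_inv h, this, inv_inv]
  · refine le_trans ?_ ((h₂ (r h)).trans (by push_cast; exact le_add_self))
    refine Set.encard_le_encard_of_injOn (f := fun g => mul g (inv h)) ?_ ?_
    · intro g hg
      obtain ⟨e, hf⟩ := hker hg
      refine ⟨subset_tsupport f hf, ?_⟩
      exact (s_mul _ _ (e.trans (r_inv h).symm)).trans (s_inv h)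
    · intro g hg g' hg' heq
      have := congrArg (fun x => mul x h) heq
      simpa only [mul_inv_cancel_right (hker hg).1, mul_inv_cancel_right (hker hg').1] using this

theorem finite_support_kernel_mul (f : C_c(G, ℂ)) (g : G) (ξ : G → ℂ) :
    (Function.support fun h => kernel f g h * ξ h).Finite := by
  obtain ⟨M, N, -, -, hrow, -⟩ := kernel_bounds f
  exact (Set.finite_of_encard_le_coe (hrow g)).subset fun h hh => left_ne_zero_of_mul hh

theorem memlp_convolution (f : C_c(G, ℂ)) (ξ : lp (fun _ : G => ℂ) 2) :
    Memℓp (fun g => ∑ᶠ h, kernel f g h * ξ h) 2 := by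
  obtain ⟨M, N, -, hM, hrow, hcol⟩ := kernel_bounds f
  refine memℓp_gen' (C := (N * M * ‖ξ‖) ^ 2) fun F => ?_
  simpa using exists_sum_sq_le _ hM hrow hcol ξ F

/-- Left convolution by `f` on `ℓ²(G) = ⨁ ℓ²(Gx)` (sum over the units `x`), as a linear map. -/
noncomputable def leftRegularLinear (f : C_c(G, ℂ)) :
    lp (fun _ : G => ℂ) 2 →ₗ[ℂ] lp (fun _ : G => ℂ) 2 where
  toFun ξ := ⟨fun g => ∑ᶠ h, kernel f g h * ξ h, memlp_convolution f ξ⟩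
  map_add' ξ η := by
    ext g
    simp only [lp.coeFn_add, Pi.add_apply, mul_add]
    exact finsum_add_distrib (finite_support_kernel_mul f g ξ) (finite_support_kernel_mul f g η)
  map_smul' c ξ := by
    ext g
    simp only [lp.coeFn_smul, Pi.smul_apply, smul_eq_mul, RingHom.id_apply]
    rw [← smul_eq_mul c, smul_finsum]
    simp only [smul_eq_mul, mul_left_comm]

theorem leftRegularLinear_bound (f : C_c(G, ℂ)) :
    ∃ C : ℝ, ∀ ξ, ‖leftRegularLinear f ξ‖ ≤ C * ‖ξ‖ := by
  obtain ⟨M, N, hM0, hM, hrow, hcol⟩ := kernel_bounds f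
  refine ⟨N * M, fun ξ => ?_⟩
  refine lp.norm_le_of_forall_sum_le (by norm_num) (by positivity) fun F => ?_
  have := exists_sum_sq_le _ hM hrow hcol ξ F
  simpa [leftRegularLinear] using this

/-- The left regular representation of `C_c(G)` on `ℓ²(G)`, the direct sum of the regular
representations on `ℓ²(Gx)` over all units `x`:
`(λ(f) ξ)(g) = ∑ f (g h⁻¹) ξ(h)`, the sum being over all `h` with `s h = s g`. -/
noncomputable def leftRegular (f : C_c(G, ℂ)) :
    lp (fun _ : G => ℂ) 2 →L[ℂ] lp (fun _ : G => ℂ) 2 :=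
  (leftRegularLinear f).mkContinuousOfExistsBound (leftRegularLinear_bound f)

theorem leftRegular_apply (f : C_c(G, ℂ)) (ξ : lp (fun _ : G => ℂ) 2) (g : G) :
    leftRegular f ξ g = ∑ᶠ h, kernel f g h * ξ h := rfl

end Operators

/-- The reduced groupoid C⋆-algebra: the C⋆-algebra of operators on `ℓ²(G)` generated by the image
of `C_c(G)` under the left regular representation. -/
noncomputable def reducedCStarAlgebra (G : Type*) [TopologicalSpace G] [EtaleGroupoid G] :
    StarSubalgebra ℂ (lp (fun _ : G => ℂ) 2 →L[ℂ] lp (fun _ : G => ℂ) 2) :=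
  (StarAlgebra.adjoin ℂ (Set.range (leftRegular (G := G)))).topologicalClosure

noncomputable instance (G : Type*) [TopologicalSpace G] [EtaleGroupoid G] :
    CStarAlgebra (reducedCStarAlgebra G) :=
  StarSubalgebra.cstarAlgebra _
    (h_closed := StarSubalgebra.isClosed_topologicalClosure _)

section Properties

variable (G : Type*) [TopologicalSpace G] [EtaleGroupoid G]

/-- A set `U` of units is invariant if `r(GU) = U`, where `GU = {g | s g ∈ U}`. -/
def IsInvariant (U : Set (unitSpace (G := G))) : Prop :=
  r '' (s ⁻¹' U) = U

/-- `G` is minimal if its unit space has no open invariant subset except `∅` and itself. -/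
def IsMinimal : Prop :=
  ∀ U : Set (unitSpace (G := G)), IsOpen U → IsInvariant G U → U = ∅ ∨ U = Set.univ

/-- `G` is essentially principal if the isotropy arrows that are not units have empty interior. -/
def IsEssentiallyPrincipal : Prop :=
  interior {g : G | g ∉ unitSpace (G := G) ∧ r g = s g} = ∅

end Properties

/-- A quotient homomorphism from `G` onto `H`: a topological quotient map (in particular,
continuous and surjective) that preserves composability and products. -/
structure IsQuotientHom {G H : Type*} [TopologicalSpace G] [EtaleGroupoid G]
    [TopologicalSpace H] [EtaleGroupoid H] (π : G → H) : Prop where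
  isQuotientMap : IsQuotientMap π
  composable : ∀ g h : G, s g = r h → s (π g) = r (π h)
  map_mul : ∀ g h : G, s g = r h → π (mul g h) = mul (π g) (π h)

end EtaleGroupoid

/-- A unital C⋆-algebra is purely infinite (and simple) if it is non-zero, has no closed two-sided
ideals except `0` and itself, and for every non-zero positive `a` there is `x` with `x a x⋆ = 1`.
The positive elements are those of the form `b⋆ b`. -/
structure IsPurelyInfinite (A : Type*) [CStarAlgebra A] : Prop where
  nontrivial : Nontrivial A
  simple : ∀ I : TwoSidedIdeal A, IsClosed (I : Set A) → I = ⊥ ∨ I = ⊤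
  exists_eq_one : ∀ a : A, a ≠ 0 → (∃ b : A, a = star b * b) → ∃ x : A, x * a * star x = 1

/-! Everything reduces to one statement: for each non-zero `b` in `C⋆_r(G)` there is `y` in
`C⋆_r(G)` such that `b y` is bounded below on `ℓ²(G)`. Then `(b y)⋆ (b y)` is invertible in
`C⋆_r(G)`, and conjugating it by its inverse square root yields `x` with `x b⋆ b x⋆ = 1`. Simplicity
follows, because any non-zero ideal then contains `1`.

The element `y` is a product `λ(φ) λ(k) λ(p ∘ π) λ(v ∘ π)`, each factor keeping the product bounded
below on the range of the next. (a) Minimality lets `G` inherit essential principality from `H`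
(`IsQuotientHom.isEssentiallyPrincipal`). So `b⋆ b`, approximated by some `λ(f)`, acts nearly as
multiplication by a function on vectors supported over a small open set `V`, and a bump `φ` over `V`
makes `b` bounded below on the range of `λ(φ)` (`exists_le_norm_apply_leftRegular`). (b) By
minimality and compactness, arrows with images in one compact subset of `H` join every unit to the
set where `φ` is large. With `k` equal to `1` on their inverses, the function representing `(λ(φ)
λ(k))⋆ (λ(φ) λ(k))` has real part at least `1/4` at every unit of `G`. Essential principality of `H`
now provides a bump `p` on `H` whose pullback isolates this diagonal
(`exists_le_norm_leftRegular_pullback`). (c) Pure infiniteness of `C⋆_r(H)` gives `v` with `λ(p)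
λ(v)` bounded below on `ℓ²(H)`. Since `π` identifies `ℓ²(Gx)` with `ℓ²(Hπ(x))`, the bound passes to
the pullbacks (`mul_norm_sq_le_norm_sq_pullback`). -/

namespace EtaleGroupoid

open ArrowGroupoid

/-! ### Algebraic identities in a groupoid -/

section Algebra

variable {G : Type*} [ArrowGroupoid G]

theorem mul_mul_inv_cancel {g h : G} (e : s g = r h) : mul (mul g h) (inv h) = g := by
  rw [assoc _ _ _ e (r_inv h).symm, ArrowGroupoid.mul_inv, ← e, mul_unit]

theorem eq_of_mul_inv_mem_unitSpace {g h : G} (e : s g = s h)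
    (hu : mul g (inv h) ∈ unitSpace (G := G)) : g = h := by
  have e' : s g = r (inv h) := e.trans (r_inv h).symm
  have h1 : mul g (inv h) = (r h : G) := by
    have := s_unit (⟨_, hu⟩ : unitSpace (G := G))
    rw [s_mul _ _ e', s_inv] at this
    exact (congrArg Subtype.val this).symm
  rw [← mul_inv_cancel_right e, h1, unit_mul]

theorem inv_mul_rev {g h : G} (e : s g = r h) : inv (mul g h) = mul (inv h) (inv g) := by
  have e1 : s (inv h) = r (inv g) := by rw [s_inv, r_inv, e]
  have e3 : s (mul (inv h) (inv g)) = r (mul g h) := by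
    rw [s_mul _ _ e1, r_mul _ _ e, s_inv]
  have h1 : mul (mul (inv h) (inv g)) (mul g h) = (s h : G) := by
    rw [assoc _ _ _ e1 ((s_inv g).trans (r_mul _ _ e).symm), inv_mul_cancel_left e, inv_mul]
  have h2 := mul_mul_inv_cancel e3
  rw [h1] at h2
  rw [← h2, ← s_mul _ _ e, ← r_inv, unit_mul]

theorem mul_inv_inv {g h : G} (e : s g = s h) : inv (mul g (inv h)) = mul h (inv g) := by
  rw [inv_mul_rev (e.trans (r_inv h).symm), inv_inv]

theorem r_mul_inv {g h : G} (e : s g = s h) : r (mul g (inv h)) = r g :=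
  r_mul _ _ (e.trans (r_inv h).symm)

theorem s_mul_inv {g h : G} (e : s g = s h) : s (mul g (inv h)) = r h := by
  rw [s_mul _ _ (e.trans (r_inv h).symm), s_inv]

theorem r_of_mem {g : G} (hg : g ∈ unitSpace (G := G)) : (r g : G) = g :=
  congrArg Subtype.val (r_unit ⟨g, hg⟩)

theorem s_of_mem {g : G} (hg : g ∈ unitSpace (G := G)) : (s g : G) = g :=
  congrArg Subtype.val (s_unit ⟨g, hg⟩)

theorem inv_of_mem {g : G} (hg : g ∈ unitSpace (G := G)) : inv g = g := by
  have h1 := mul_inv g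
  have h2 : (r g : G) = g := r_of_mem hg
  have h3 := unit_mul (inv g)
  rw [r_inv, s_of_mem hg] at h3
  rw [h3] at h1
  exact h1.trans h2

end Algebra

/-! ### The unit space as an open compact subset -/

section Topology

variable {G : Type*} [TopologicalSpace G] [EtaleGroupoid G]

theorem continuous_r : Continuous (r : G → unitSpace (G := G)) := isLocalHomeomorph_r.continuous

theorem continuous_s : Continuous (s : G → unitSpace (G := G)) := isLocalHomeomorph_s.continuous

/-- Since `s (s g) = s g`, local injectivity of `s` forces `s g = g` as soon as both `g` and `s g`
are close to a given unit. -/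
theorem isOpen_unitSpace : IsOpen (unitSpace (G := G)) := by
  rw [isOpen_iff_mem_nhds]
  intro x hx
  obtain ⟨U, hU, hxU, hinj⟩ := (isLocalHomeomorph_s (G := G)).isLocallyInjective x
  have hc : Continuous fun g : G => (s g : G) := continuous_subtype_val.comp continuous_s
  have hsx : (s x : G) ∈ U := by rwa [s_of_mem hx]
  filter_upwards [hU.mem_nhds hxU, hc.continuousAt.preimage_mem_nhds (hU.mem_nhds hsx)] with g h1 h2
  have : (s g : G) = g := hinj h2 h1 (s_unit _)
  rw [← this]
  exact (s g).2

variable (G) in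
theorem isCompact_unitSpace [CompactSpace (unitSpace (G := G))] :
    IsCompact (unitSpace (G := G)) := isCompact_iff_compactSpace.2 inferInstance

end Topology

/-! ### Matrix entries of the regular representation -/

section Matrix

/-- Operators on `ℓ²` with the same matrix are equal. -/
theorem clm_ext {ι F : Type*} [NormedAddCommGroup F] [NormedSpace ℂ F] [DecidableEq ι]
    {S T : lp (fun _ : ι => ℂ) 2 →L[ℂ] F}
    (h : ∀ j, S (lp.single 2 j 1) = T (lp.single 2 j 1)) : S = T := by
  refine lp.ext_continuousLinearMap (by norm_num) fun j => ?_
  ext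
  simpa using h j

theorem star_apply_single {ι : Type*} [DecidableEq ι]
    (S : lp (fun _ : ι => ℂ) 2 →L[ℂ] lp (fun _ : ι => ℂ) 2) (i j : ι) :
    (star S) (lp.single 2 j 1) i = star (S (lp.single 2 i 1) j) := by
  have h := ContinuousLinearMap.adjoint_inner_right S (lp.single 2 i 1) (lp.single 2 j 1)
  rw [lp.inner_single_left, lp.inner_single_right] at h
  simpa [ContinuousLinearMap.star_eq_adjoint] using h

variable {G : Type*} [TopologicalSpace G] [EtaleGroupoid G]

theorem leftRegular_single [DecidableEq G] (f : C_c(G, ℂ)) (g h : G) :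
    leftRegular f (lp.single 2 h 1) g = kernel f g h := by
  rw [leftRegular_apply, finsum_eq_single _ h]
  · simp
  · intro k hk
    rw [lp.single_apply_ne _ _ _ hk, mul_zero]

theorem kernel_of_eq (f : C_c(G, ℂ)) {g h : G} (e : s g = s h) :
    kernel f g h = f (mul g (inv h)) := if_pos e

theorem kernel_of_ne (f : C_c(G, ℂ)) {g h : G} (e : s g ≠ s h) : kernel f g h = 0 := if_neg e

/-- The columns at units recover `f`; this is how function values are read off from operators. -/
theorem kernel_s (f : C_c(G, ℂ)) (g : G) : kernel f g (s g) = f g := by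
  rw [kernel_of_eq _ (s_unit (s g)).symm, inv_of_mem (s g).2, mul_unit]

theorem leftRegular_eq_of_kernel [DecidableEq G] {f : C_c(G, ℂ)}
    {T : lp (fun _ : G => ℂ) 2 →L[ℂ] lp (fun _ : G => ℂ) 2}
    (h : ∀ j i, T (lp.single 2 j 1) i = kernel f i j) :
    T = leftRegular f := by
  refine clm_ext fun j => ?_
  ext i
  rw [leftRegular_single, ← h]

theorem leftRegular_add (f g : C_c(G, ℂ)) :
    leftRegular (f + g) = leftRegular f + leftRegular g := by
  classical
  refine (leftRegular_eq_of_kernel fun j i => ?_).symm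
  simp only [_root_.add_apply, lp.coeFn_add, Pi.add_apply]
  rw [leftRegular_single, leftRegular_single]
  unfold kernel
  split_ifs <;> simp

theorem leftRegular_smul (c : ℂ) (f : C_c(G, ℂ)) :
    leftRegular (c • f) = c • leftRegular f := by
  classical
  refine (leftRegular_eq_of_kernel fun j i => ?_).symm
  simp only [_root_.smul_apply, lp.coeFn_smul, Pi.smul_apply]
  rw [leftRegular_single]
  unfold kernel
  split_ifs <;> simp

theorem inv_involutive : Function.Involutive (inv : G → G) := inv_inv

/-- The inverse of an étale groupoid as a homeomorphism. -/
def invHomeomorph (G : Type*) [TopologicalSpace G] [EtaleGroupoid G] : G ≃ₜ G where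
  toEquiv := inv_involutive.toPerm
  continuous_toFun := continuous_inv
  continuous_invFun := continuous_inv

/-- The involution `f⋆(g) = conj (f (g⁻¹))` of `C_c(G)`. -/
noncomputable def involution (f : C_c(G, ℂ)) : C_c(G, ℂ) where
  toFun g := star (f (inv g))
  continuous_toFun := continuous_star.comp (f.continuous.comp continuous_inv)
  hasCompactSupport' :=
    (f.hasCompactSupport.comp_homeomorph (invHomeomorph G)).comp_left (g := star) (star_zero ℂ)

theorem involution_apply (f : C_c(G, ℂ)) (g : G) : involution f g = star (f (inv g)) := rfl

theorem star_leftRegular (f : C_c(G, ℂ)) : star (leftRegular f) = leftRegular (involution f) := by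
  classical
  refine leftRegular_eq_of_kernel fun j i => ?_
  rw [star_apply_single, leftRegular_single]
  by_cases e : s i = s j
  · rw [kernel_of_eq _ e, kernel_of_eq _ e.symm, involution_apply, mul_inv_inv e]
  · rw [kernel_of_ne _ e, kernel_of_ne _ (Ne.symm e), star_zero]

/-- A function on `G` vanishing off the unit space acts by multiplication. -/
theorem leftRegular_apply_of_unit (f : C_c(G, ℂ)) (hf : ∀ g ∉ unitSpace (G := G), f g = 0)
    (ξ : lp (fun _ : G => ℂ) 2) (g : G) : leftRegular f ξ g = f (r g) * ξ g := by
  rw [leftRegular_apply, finsum_eq_single _ g]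
  · rw [kernel_of_eq _ rfl, ArrowGroupoid.mul_inv]
  · intro h hne
    by_cases e : s g = s h
    · rw [kernel_of_eq _ e, hf _ fun hu => hne (eq_of_mul_inv_mem_unitSpace e hu).symm, zero_mul]
    · rw [kernel_of_ne _ e, zero_mul]

end Matrix

/-! ### Convolution and approximation by compactly supported functions -/

section Convolution

variable {G : Type*} [TopologicalSpace G] [T2Space G] [EtaleGroupoid G]

theorem isCompact_mul_image {K L : Set G} (hK : IsCompact K) (hL : IsCompact L) :
    IsCompact ((fun p : G × G => mul p.1 p.2) '' ((K ×ˢ L) ∩ {p : G × G | s p.1 = r p.2})) := by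
  refine IsCompact.image_of_continuousOn ?_ (continuousOn_mul.mono Set.inter_subset_right)
  exact (hK.prod hL).inter_right
    (isClosed_eq (continuous_s.comp continuous_fst) (continuous_r.comp continuous_snd))

/-- The convolution of `f` with a function whose support lies in the domain of a local inverse of
the source map. -/
theorem exists_leftRegular_mul_of_tsupport_subset (f g : C_c(G, ℂ))
    (e : OpenPartialHomeomorph G (unitSpace (G := G))) (he : (s : G → unitSpace (G := G)) = e)
    (hg : tsupport g ⊆ e.source) :
    ∃ h : C_c(G, ℂ), leftRegular f * leftRegular g = leftRegular h := by
  classical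
  have hσ : ∀ x ∈ e.target, s (e.symm x) = x := fun x hx => by rw [he]; exact e.right_inv hx
  have hcomp : ∀ γ : G, s γ ∈ e.target → s γ = s (e.symm (s γ)) := fun γ hγ => (hσ _ hγ).symm
  -- In the sum of `f (γ k⁻¹) g k` over `k` with `s k = s γ`, only the `k` in `e.source` can
  -- contribute, and `s` is injective there, so one term remains.
  let h₀ : G → ℂ := fun γ =>
    if s γ ∈ e.target then f (mul γ (inv (e.symm (s γ)))) * g (e.symm (s γ)) else 0
  have hO : IsOpen (s ⁻¹' e.target : Set G) := e.open_target.preimage continuous_s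
  have hcont : Continuous h₀ := by
    rw [continuous_iff_continuousAt]
    intro γ
    by_cases hγ : s γ ∈ e.target
    · have hsec : ContinuousOn (fun γ : G => e.symm (s γ)) (s ⁻¹' e.target) :=
        e.continuousOn_symm.comp continuous_s.continuousOn fun _ h => h
      have h1 : ContinuousOn (fun γ : G => mul γ (inv (e.symm (s γ)))) (s ⁻¹' e.target) :=
        continuousOn_mul.comp (t := {p : G × G | s p.1 = r p.2})
          (continuousOn_id.prodMk (continuous_inv.comp_continuousOn hsec))
          fun γ' h' => (hcomp γ' h').trans (r_inv _).symm
      have h2 : ContinuousOn h₀ (s ⁻¹' e.target) :=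
        ((f.continuous.comp_continuousOn h1).mul (g.continuous.comp_continuousOn hsec)).congr
          fun γ' h' => if_pos h'
      exact h2.continuousAt (hO.mem_nhds hγ)
    -- Off the target, `s γ` avoids the compact set `s (tsupport g)`, so `h₀` vanishes in a
    -- neighbourhood of `γ`.
    · have hcl : IsClosed (s '' tsupport g) :=
        (IsCompact.image g.hasCompactSupport continuous_s).isClosed
      have hmem : γ ∈ (s ⁻¹' (s '' tsupport g))ᶜ := by
        rintro ⟨k, hk, hks⟩
        rw [← hks, he] at hγ
        exact hγ (e.map_source (hg hk))
      refine (continuousAt_const (y := (0 : ℂ))).congr ?_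
      filter_upwards [(hcl.preimage continuous_s).isOpen_compl.mem_nhds hmem] with γ' hγ'
      simp only [h₀]
      split_ifs with h
      · rw [image_eq_zero_of_notMem_tsupport fun hk => hγ' ⟨_, hk, hσ _ h⟩, mul_zero]
      · rfl
  have hsupp : HasCompactSupport h₀ := by
    refine HasCompactSupport.intro
      (isCompact_mul_image f.hasCompactSupport g.hasCompactSupport) fun γ hγ => ?_
    simp only [h₀]
    split_ifs with h
    · by_contra hne
      refine hγ ⟨(mul γ (inv (e.symm (s γ))), e.symm (s γ)), ⟨⟨?_, ?_⟩, ?_⟩, ?_⟩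
      · exact subset_tsupport f (left_ne_zero_of_mul hne)
      · exact subset_tsupport g (right_ne_zero_of_mul hne)
      · exact s_mul_inv (hcomp γ h)
      · exact mul_inv_cancel_right (hcomp γ h)
    · rfl
  refine ⟨⟨⟨h₀, hcont⟩, hsupp⟩, leftRegular_eq_of_kernel fun l i => ?_⟩
  change leftRegular f (leftRegular g (lp.single 2 l 1)) i = _
  have hval : ∀ k, kernel g k l ≠ 0 → s k = s l ∧ r l ∈ e.target ∧ k = mul (e.symm (r l)) l := by
    intro k hk
    have e1 : s k = s l := by
      by_contra e1
      exact hk (kernel_of_ne _ e1)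
    rw [kernel_of_eq _ e1] at hk
    have hsrc := hg (subset_tsupport g hk)
    have e2 : e (mul k (inv l)) = r l := by rw [← he]; exact s_mul_inv e1
    refine ⟨e1, e2 ▸ e.map_source hsrc, ?_⟩
    rw [← e2, e.left_inv hsrc, mul_inv_cancel_right e1]
  by_cases hl : r l ∈ e.target
  · have e1 : s (e.symm (r l)) = r l := hσ _ hl
    have hsingle : leftRegular g (lp.single 2 l 1)
        = g (e.symm (r l)) • lp.single 2 (mul (e.symm (r l)) l) 1 := by
      ext k
      rw [leftRegular_single, lp.coeFn_smul, Pi.smul_apply]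
      by_cases hk : k = mul (e.symm (r l)) l
      · subst hk
        rw [lp.single_apply_self, kernel_of_eq _ (s_mul _ _ e1), mul_mul_inv_cancel e1,
          smul_eq_mul, mul_one]
      · rw [lp.single_apply_ne _ _ _ hk, smul_zero]
        by_contra hne
        exact hk (hval k hne).2.2
    rw [hsingle, map_smul, lp.coeFn_smul, Pi.smul_apply, leftRegular_single]
    by_cases ei : s i = s l
    · have e2 : s (mul i (inv l)) = r l := s_mul_inv ei
      rw [kernel_of_eq _ ei, kernel_of_eq _ (ei.trans (s_mul _ _ e1).symm)]
      change _ = h₀ _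
      simp only [h₀]
      rw [e2, if_pos hl, inv_mul_rev e1, assoc _ _ _ (ei.trans (r_inv l).symm)
        (by rw [s_inv, r_inv, e1]), smul_eq_mul, mul_comm]
    · rw [kernel_of_ne _ ei, kernel_of_ne _ (by rwa [s_mul _ _ e1]), smul_zero]
  · have hzero : leftRegular g (lp.single 2 l 1) = 0 := by
      ext k
      rw [leftRegular_single]
      by_contra hne
      exact hl (hval k hne).2.1
    rw [hzero, map_zero]
    by_cases ei : s i = s l
    · rw [kernel_of_eq _ ei]
      change _ = h₀ _
      simp only [h₀]
      rw [s_mul_inv ei, if_neg hl]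
      rfl
    · rw [kernel_of_ne _ ei]
      rfl

/-- The left regular representation as an additive map. -/
noncomputable def leftRegularAddHom (G : Type*) [TopologicalSpace G] [EtaleGroupoid G] :
    C_c(G, ℂ) →+ (lp (fun _ : G => ℂ) 2 →L[ℂ] lp (fun _ : G => ℂ) 2) :=
  AddMonoidHom.mk' leftRegular leftRegular_add

/-- `C_c(G)` is closed under convolution. -/
theorem exists_leftRegular_mul [LocallyCompactSpace G] (f g : C_c(G, ℂ)) :
    ∃ h : C_c(G, ℂ), leftRegular f * leftRegular g = leftRegular h := by
  -- A partition of unity on the support of `g` splits it into pieces to which the preceding case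
  -- applies.
  choose e hmem he using isLocalHomeomorph_s (G := G)
  obtain ⟨t, ht⟩ := IsCompact.elim_finite_subcover g.hasCompactSupport (fun x : G => (e x).source)
    (fun x => (e x).open_source) fun x _ => Set.mem_iUnion.2 ⟨x, hmem x⟩
  obtain ⟨χ, hχ, hsum, -, -⟩ := exists_continuous_sum_one_of_isOpen_isCompact
    (s := fun i : Fin t.card => (e (t.equivFin.symm i)).source)
    (fun i => (e _).open_source) g.hasCompactSupport (fun x hx => by
      obtain ⟨y, hy, hxy⟩ := Set.mem_iUnion₂.1 (ht hx)
      exact Set.mem_iUnion.2 ⟨t.equivFin ⟨y, hy⟩, by simpa using hxy⟩)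
  let gi : Fin t.card → C_c(G, ℂ) := fun i =>
    ⟨⟨fun x => (χ i x : ℂ) * g x,
      (Complex.continuous_ofReal.comp (χ i).continuous).mul g.continuous⟩,
      HasCompactSupport.mul_left (f := fun x => (χ i x : ℂ)) g.hasCompactSupport⟩
  have hgi : g = ∑ i, gi i := by
    ext x
    rw [CompactlySupportedContinuousMap.sum_apply]
    change g x = ∑ i, (χ i x : ℂ) * g x
    rw [← Finset.sum_mul]
    by_cases hx : x ∈ tsupport g
    · have := hsum hx
      simp only [Finset.sum_apply, Pi.one_apply] at this
      rw [← Complex.ofReal_sum, this, Complex.ofReal_one, one_mul]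
    · rw [image_eq_zero_of_notMem_tsupport hx, mul_zero]
  have hex : ∀ i, ∃ h : C_c(G, ℂ), leftRegular f * leftRegular (gi i) = leftRegular h := fun i => by
    refine exists_leftRegular_mul_of_tsupport_subset f (gi i) _ (he (t.equivFin.symm i)) ?_
    refine subset_trans (closure_mono fun x hx => ?_) (hχ i)
    have : (χ i x : ℂ) * g x ≠ 0 := hx
    exact fun h0 => this (by simp [h0])
  choose h hh using hex
  refine ⟨∑ i, h i, ?_⟩
  change leftRegularAddHom G f * leftRegularAddHom G g = leftRegularAddHom G (∑ i, h i)
  rw [map_sum, hgi, map_sum, Finset.mul_sum]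
  exact Finset.sum_congr rfl fun i _ => hh i

/-- The characteristic function of the unit space. -/
noncomputable def unitFunction (G : Type*) [TopologicalSpace G] [T2Space G] [EtaleGroupoid G]
    [CompactSpace (unitSpace (G := G))] : C_c(G, ℂ) where
  toFun := (unitSpace (G := G)).indicator 1
  continuous_toFun :=
    continuous_one.indicator fun x hx => by
      rw [IsClopen.frontier_eq ⟨(isCompact_unitSpace G).isClosed, isOpen_unitSpace⟩] at hx
      exact hx.elim
  hasCompactSupport' := HasCompactSupport.intro (isCompact_unitSpace G) fun x hx => by simp [hx]

variable [CompactSpace (unitSpace (G := G))]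

theorem leftRegular_unitFunction : leftRegular (unitFunction G) = 1 := by
  refine ContinuousLinearMap.ext fun ξ => ?_
  ext g
  rw [leftRegular_apply_of_unit]
  · change (unitSpace (G := G)).indicator 1 (r g : G) * ξ g = ξ g
    simp
  · intro g hg
    exact Set.indicator_of_notMem hg _

variable [LocallyCompactSpace G]

/-- The image of `C_c(G)` under the left regular representation, as a star-subalgebra. -/
noncomputable def leftRegularRange (G : Type*) [TopologicalSpace G] [T2Space G] [EtaleGroupoid G]
    [CompactSpace (unitSpace (G := G))] [LocallyCompactSpace G] :
    StarSubalgebra ℂ (lp (fun _ : G => ℂ) 2 →L[ℂ] lp (fun _ : G => ℂ) 2) where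
  carrier := Set.range leftRegular
  mul_mem' := by
    rintro _ _ ⟨f, rfl⟩ ⟨g, rfl⟩
    obtain ⟨h, hh⟩ := exists_leftRegular_mul f g
    exact ⟨h, hh.symm⟩
  add_mem' := by
    rintro _ _ ⟨f, rfl⟩ ⟨g, rfl⟩
    exact ⟨f + g, leftRegular_add f g⟩
  algebraMap_mem' c := ⟨c • unitFunction G, by
    rw [leftRegular_smul, leftRegular_unitFunction, Algebra.algebraMap_eq_smul_one]⟩
  star_mem' := by
    rintro _ ⟨f, rfl⟩
    exact ⟨_, (star_leftRegular f).symm⟩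

/-- The image of `C_c(G)` is already a unital star-subalgebra, so adjoining adds nothing before the
closure is taken. -/
theorem mem_reducedCStarAlgebra_iff
    {a : lp (fun _ : G => ℂ) 2 →L[ℂ] lp (fun _ : G => ℂ) 2} :
    a ∈ reducedCStarAlgebra G ↔ a ∈ closure (Set.range (leftRegular (G := G))) := by
  have h : StarAlgebra.adjoin ℂ (Set.range (leftRegular (G := G))) = leftRegularRange G :=
    le_antisymm (StarAlgebra.adjoin_le fun _ h => h) (StarAlgebra.subset_adjoin ℂ _)
  unfold reducedCStarAlgebra
  rw [h]
  rfl

theorem leftRegular_mem (f : C_c(G, ℂ)) : leftRegular f ∈ reducedCStarAlgebra G :=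
  mem_reducedCStarAlgebra_iff.2 (subset_closure ⟨f, rfl⟩)

theorem exists_norm_sub_leftRegular_lt
    {a : lp (fun _ : G => ℂ) 2 →L[ℂ] lp (fun _ : G => ℂ) 2} (ha : a ∈ reducedCStarAlgebra G)
    {ε : ℝ} (hε : 0 < ε) : ∃ f : C_c(G, ℂ), ‖a - leftRegular f‖ < ε := by
  obtain ⟨_, ⟨f, rfl⟩, hf⟩ := Metric.mem_closure_iff.1 (mem_reducedCStarAlgebra_iff.1 ha) ε hε
  exact ⟨f, by rwa [← dist_eq_norm]⟩

/-- An element of the reduced C⋆-algebra is determined by its values on the point masses at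
units. -/
theorem eq_zero_of_apply_single_unit [DecidableEq G]
    {a : lp (fun _ : G => ℂ) 2 →L[ℂ] lp (fun _ : G => ℂ) 2} (ha : a ∈ reducedCStarAlgebra G)
    (h : ∀ x : unitSpace (G := G), a (lp.single 2 (x : G) 1) = 0) : a = 0 := by
  have hcont : ∀ i j : G, Continuous fun a : lp (fun _ : G => ℂ) 2 →L[ℂ] lp (fun _ : G => ℂ) 2 =>
      a (lp.single 2 j 1) i := fun i j => by
    have h1 : (fun a : lp (fun _ : G => ℂ) 2 →L[ℂ] lp (fun _ : G => ℂ) 2 =>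
        a (lp.single 2 j 1) i) = fun a => inner ℂ (lp.single 2 i (1 : ℂ)) (a (lp.single 2 j 1)) := by
      ext a
      rw [lp.inner_single_left]
      simp
    rw [h1]
    fun_prop
  -- Matrix entries depend continuously on the operator. So the vanishing between different source
  -- fibres, and below the invariance under right translation, pass from the operators `λ(f)` to
  -- their closure; the columns at units then determine all columns.
  have hne : ∀ i j : G, s i ≠ s j → a (lp.single 2 j 1) i = 0 := fun i j e => by
    refine Set.EqOn.closure (s := Set.range (leftRegular (G := G))) (g := fun _ => (0 : ℂ)) ?_
      (hcont i j) continuous_const (mem_reducedCStarAlgebra_iff.1 ha)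
    rintro _ ⟨f, rfl⟩
    exact (leftRegular_single f i j).trans (kernel_of_ne f e)
  have heq : ∀ i j : G, s i = s j →
      a (lp.single 2 j 1) i = a (lp.single 2 (r j : G) 1) (mul i (inv j)) := fun i j e => by
    refine Set.EqOn.closure (s := Set.range (leftRegular (G := G))) ?_
      (hcont i j) (hcont _ _) (mem_reducedCStarAlgebra_iff.1 ha)
    rintro _ ⟨f, rfl⟩
    have h1 := leftRegular_single f i j
    have h2 := leftRegular_single f (mul i (inv j)) (r j : G)
    rw [← s_mul_inv e, kernel_s, s_mul_inv e] at h2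
    rw [kernel_of_eq _ e, ← h2] at h1
    exact h1
  refine clm_ext fun j => ?_
  ext i
  by_cases e : s i = s j
  · rw [heq i j e, h]
    rfl
  · rw [hne i j e]
    rfl

end Convolution

/-! ### Nowhere dense sets, minimality and essential principality -/

section Dynamics

variable {G : Type*} [TopologicalSpace G] [EtaleGroupoid G]

/-- Translating a nowhere dense closed set of units by a compact set of arrows yields a set with
dense exterior. -/
theorem exists_isOpen_subset_of_interior_eq_empty {C : Set (unitSpace (G := G))}
    (hC : IsClosed C) (hCi : interior C = ∅) {K : Set G} (hK : IsCompact K)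
    {U : Set (unitSpace (G := G))} (hU : IsOpen U) (hUne : U.Nonempty) :
    ∃ V ⊆ U, IsOpen V ∧ V.Nonempty ∧ ∀ k ∈ K, r k ∈ V → s k ∉ C := by
  -- The induction over compact sets keeps `U` arbitrary, so that for a union the open set found for
  -- one piece can be shrunk again for the other.
  revert U
  refine hK.induction_on (p := fun S => ∀ {U : Set (unitSpace (G := G))}, IsOpen U → U.Nonempty →
    ∃ V ⊆ U, IsOpen V ∧ V.Nonempty ∧ ∀ k ∈ S, r k ∈ V → s k ∉ C) ?_ ?_ ?_ ?_
  · exact fun hU hUne => ⟨_, subset_rfl, hU, hUne, by simp⟩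
  · intro S T hST hT U hU hUne
    obtain ⟨V, hVU, hV, hVne, h⟩ := hT hU hUne
    exact ⟨V, hVU, hV, hVne, fun k hk => h k (hST hk)⟩
  · intro S T hS hT U hU hUne
    obtain ⟨V, hVU, hV, hVne, h⟩ := hS hU hUne
    obtain ⟨V', hVV, hV', hVne', h'⟩ := hT hV hVne
    refine ⟨V', hVV.trans hVU, hV', hVne', ?_⟩
    rintro k (hk | hk) h1
    · exact h k hk (hVV h1)
    · exact h' k hk h1
  · intro x hx
    obtain ⟨O, hO, hxO, hinj⟩ := (isLocalHomeomorph_r (G := G)).isLocallyInjective x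
    refine ⟨O, mem_nhdsWithin_of_mem_nhds (hO.mem_nhds hxO), ?_⟩
    intro U hU hUne
    rcases (O ∩ r ⁻¹' U).eq_empty_or_nonempty with hem | hne
    · refine ⟨U, subset_rfl, hU, hUne, fun k hk h2 => ?_⟩
      exact ((hem ▸ (⟨hk, h2⟩ : k ∈ O ∩ r ⁻¹' U) : k ∈ (∅ : Set G))).elim
    · have hOU : IsOpen (O ∩ r ⁻¹' U) := hO.inter (hU.preimage continuous_r)
      -- Otherwise the open map `s` would send a non-empty open set into `C`, which has empty
      -- interior.
      have : ∃ g ∈ O ∩ r ⁻¹' U, s g ∉ C := by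
        by_contra! hcon
        have := interior_maximal (Set.image_subset_iff.2 hcon)
          (isLocalHomeomorph_s.isOpenMap _ hOU)
        rw [hCi] at this
        exact Set.not_nonempty_empty ((hne.image _).mono this)
      obtain ⟨g, hg, hgC⟩ := this
      refine ⟨r '' (O ∩ r ⁻¹' U ∩ s ⁻¹' Cᶜ), ?_, isLocalHomeomorph_r.isOpenMap _
        (hOU.inter (hC.isOpen_compl.preimage continuous_s)), ⟨r g, g, ⟨hg, hgC⟩, rfl⟩, ?_⟩
      · rintro _ ⟨k, hk, rfl⟩
        exact hk.1.2
      · rintro k hk ⟨k', hk', hkk⟩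
        -- Injectivity of `r` on `O` makes `k` the very arrow that witnesses `r k ∈ V`.
        have : k' = k := hinj hk'.1.1 hk hkk
        subst this
        exact hk'.2

/-- In a minimal groupoid each unit is the range of an arrow with source in a given non-empty open
set. -/
theorem IsMinimal.exists_arrow (hG : IsMinimal G) {U : Set (unitSpace (G := G))} (hU : IsOpen U)
    (hUne : U.Nonempty) (z : unitSpace (G := G)) : ∃ g : G, r g = z ∧ s g ∈ U := by
  have hinv : IsInvariant G (r '' (s ⁻¹' U)) := by
    apply Set.Subset.antisymm
    · rintro _ ⟨g, ⟨h, hh, hgh⟩, rfl⟩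
      exact ⟨mul g h, by rwa [Set.mem_preimage, s_mul _ _ hgh.symm], r_mul _ _ hgh.symm⟩
    · intro z hz
      exact ⟨z, by rwa [Set.mem_preimage, s_unit], r_unit z⟩
  rcases hG _ (isLocalHomeomorph_r.isOpenMap _ (hU.preimage continuous_s)) hinv with h | h
  · obtain ⟨x, hx⟩ := hUne
    have : x ∈ r '' (s ⁻¹' U) := ⟨x, by rwa [Set.mem_preimage, s_unit], r_unit x⟩
    rw [h] at this
    exact this.elim
  · have : z ∈ r '' (s ⁻¹' U) := h ▸ Set.mem_univ z
    obtain ⟨g, hg, rfl⟩ := this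
    exact ⟨g, rfl, hg⟩

variable [T2Space G]

theorem isClosed_unitSpace : IsClosed (unitSpace (G := G)) := by
  have : unitSpace (G := G) = {g : G | (s g : G) = g} :=
    Set.ext fun g => ⟨fun hg => s_of_mem hg, fun hg => hg ▸ (s g).2⟩
  rw [this]
  exact isClosed_eq (continuous_subtype_val.comp continuous_s) continuous_id

/-- In an essentially principal groupoid, each non-empty open set of units contains a non-empty
open set that no arrow of a given compact set of non-units connects to itself. -/
theorem IsEssentiallyPrincipal.exists_isOpen_subset (hG : IsEssentiallyPrincipal G)
    {K : Set G} (hK : IsCompact K) (hKu : Disjoint K (unitSpace (G := G)))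
    {U : Set (unitSpace (G := G))} (hU : IsOpen U) (hUne : U.Nonempty) :
    ∃ V ⊆ U, IsOpen V ∧ V.Nonempty ∧ ∀ k ∈ K, r k ∈ V → s k ∉ V := by
  revert U
  refine hK.induction_on (p := fun S => ∀ {U : Set (unitSpace (G := G))}, IsOpen U → U.Nonempty →
    ∃ V ⊆ U, IsOpen V ∧ V.Nonempty ∧ ∀ k ∈ S, r k ∈ V → s k ∉ V) ?_ ?_ ?_ ?_
  · exact fun hU hUne => ⟨_, subset_rfl, hU, hUne, by simp⟩
  · intro S T hST hT U hU hUne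
    obtain ⟨V, hVU, hV, hVne, h⟩ := hT hU hUne
    exact ⟨V, hVU, hV, hVne, fun k hk => h k (hST hk)⟩
  · intro S T hS hT U hU hUne
    obtain ⟨V, hVU, hV, hVne, h⟩ := hS hU hUne
    obtain ⟨V', hVV, hV', hVne', h'⟩ := hT hV hVne
    refine ⟨V', hVV.trans hVU, hV', hVne', ?_⟩
    rintro k (hk | hk) h1 h2
    · exact h k hk (hVV h1) (hVV h2)
    · exact h' k hk h1 h2
  · intro x hx
    obtain ⟨O, hO, hxO, hinj⟩ := (isLocalHomeomorph_s (G := G)).isLocallyInjective x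
    have hxu : x ∉ unitSpace (G := G) := fun h => Set.disjoint_left.1 hKu hx h
    refine ⟨O ∩ (unitSpace (G := G))ᶜ, mem_nhdsWithin_of_mem_nhds
      ((hO.inter isClosed_unitSpace.isOpen_compl).mem_nhds ⟨hxO, hxu⟩), ?_⟩
    intro U hU hUne
    have hSo : IsOpen (O ∩ (unitSpace (G := G))ᶜ) := hO.inter isClosed_unitSpace.isOpen_compl
    rcases (O ∩ (unitSpace (G := G))ᶜ ∩ s ⁻¹' U).eq_empty_or_nonempty with hem | hne
    · refine ⟨U, subset_rfl, hU, hUne, fun k hk _ h2 => ?_⟩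
      exact (hem ▸ (⟨hk, h2⟩ : k ∈ O ∩ (unitSpace (G := G))ᶜ ∩ s ⁻¹' U) : k ∈ (∅ : Set G))
    · have : ∃ g ∈ O ∩ (unitSpace (G := G))ᶜ ∩ s ⁻¹' U, r g ≠ s g := by
        by_contra! hcon
        have := interior_maximal (s := {g : G | g ∉ unitSpace (G := G) ∧ r g = s g})
          (fun g hg => ⟨hg.1.2, hcon g hg⟩) (hSo.inter (hU.preimage continuous_s))
        rw [hG] at this
        exact Set.not_nonempty_empty (hne.mono this)
      obtain ⟨g, ⟨hgS, hgU⟩, hrs⟩ := this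
      obtain ⟨A, B, hA, hB, hgA, hgB, hAB⟩ := t2_separation hrs
      -- An arrow of `O` with source in this set is, by injectivity of `s` on `O`, one with range in
      -- `A`, hence with range outside `B`.
      refine ⟨U ∩ B ∩ s '' (O ∩ (unitSpace (G := G))ᶜ ∩ r ⁻¹' A),
        fun x hx => hx.1.1, (hU.inter hB).inter
          (isLocalHomeomorph_s.isOpenMap _ (hSo.inter (hA.preimage continuous_r))),
        ⟨s g, ⟨hgU, hgB⟩, g, ⟨hgS, hgA⟩, rfl⟩, ?_⟩
      rintro k hk h1 ⟨-, k', hk', hkk⟩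
      have : k' = k := hinj hk'.1.1 hk.1 hkk
      subst this
      exact Set.disjoint_left.1 hAB hk'.2 h1.1.2

end Dynamics

/-! ### Quotient homomorphisms and lifting of essential principality -/

section Quotient

variable {G H : Type*} [TopologicalSpace G] [EtaleGroupoid G]
  [TopologicalSpace H] [EtaleGroupoid H] {π : G → H}

namespace IsQuotientHom

theorem map_mem_unitSpace (hπ : IsQuotientHom π) (x : unitSpace (G := G)) :
    π x ∈ unitSpace (G := H) := by
  have e : s (x : G) = r (x : G) := by rw [s_unit, r_unit]
  have h1 := hπ.map_mul _ _ e
  have h2 : mul (x : G) x = x := by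
    have := mul_unit (x : G)
    rwa [s_unit] at this
  rw [h2] at h1
  have h3 := mul_mul_inv_cancel (hπ.composable _ _ e)
  rw [← h1, ArrowGroupoid.mul_inv] at h3
  exact h3 ▸ (r _).2

/-- The map between the unit spaces induced by a quotient homomorphism. -/
def unitMap (hπ : IsQuotientHom π) (x : unitSpace (G := G)) : unitSpace (G := H) :=
  ⟨π x, hπ.map_mem_unitSpace x⟩

theorem continuous_unitMap (hπ : IsQuotientHom π) : Continuous hπ.unitMap :=
  (hπ.isQuotientMap.continuous.comp continuous_subtype_val).subtype_mk _

theorem s_map (hπ : IsQuotientHom π) (g : G) : s (π g) = hπ.unitMap (s g) := by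
  rw [hπ.composable g (s g) (by rw [r_unit])]
  exact Subtype.ext (r_of_mem (hπ.map_mem_unitSpace _))

theorem r_map (hπ : IsQuotientHom π) (g : G) : r (π g) = hπ.unitMap (r g) := by
  rw [← hπ.composable (r g) g (by rw [s_unit])]
  exact Subtype.ext (s_of_mem (hπ.map_mem_unitSpace _))

theorem map_inv (hπ : IsQuotientHom π) (g : G) : π (inv g) = inv (π g) := by
  have e := hπ.composable g (inv g) (r_inv g).symm
  have h1 := hπ.map_mul g (inv g) (r_inv g).symm
  have h2 := inv_mul_cancel_left e
  rw [← h1, ArrowGroupoid.mul_inv] at h2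
  have h3 : π (r g) = r (π g) := by rw [hπ.r_map]; rfl
  rw [← h2, h3, ← s_inv, mul_unit]

theorem surjective_unitMap (hπ : IsQuotientHom π) : Function.Surjective hπ.unitMap := by
  intro y
  obtain ⟨g, hg⟩ := hπ.isQuotientMap.surjective (y : H)
  exact ⟨s g, by rw [← hπ.s_map, hg, s_unit]⟩

/-- If `π g` is a unit, it equals its source `π (s g)`; as `g` and `s g` lie in the same fibre, they
coincide. -/
theorem mem_unitSpace_of_map (hπ : IsQuotientHom π)
    (hinj : ∀ x : unitSpace (G := G), Set.InjOn π {g : G | s g = x}) {g : G}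
    (hg : π g ∈ unitSpace (G := H)) : g ∈ unitSpace (G := G) := by
  have h1 : π (s g) = π g := by
    have := congrArg Subtype.val (hπ.s_map g)
    rw [s_of_mem hg] at this
    exact this.symm
  have := hinj (s g) (s_unit (s g)) rfl h1
  exact this ▸ (s g).2

/-- Minimality gives one arrow for each unit; since `r` is open, it also serves nearby units, and
compactness of the unit space reduces to finitely many compact neighbourhoods in `H`. -/
theorem exists_isCompact_arrows [CompactSpace (unitSpace (G := G))] [LocallyCompactSpace H]
    (hπ : IsQuotientHom π) (hG : IsMinimal G) {U : Set (unitSpace (G := G))} (hU : IsOpen U)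
    (hUne : U.Nonempty) :
    ∃ K : Set H, IsCompact K ∧ ∀ z, ∃ g : G, r g = z ∧ s g ∈ U ∧ π g ∈ K := by
  choose γ hr hs using fun z => hG.exists_arrow hU hUne z
  choose C hC hmem using fun z => exists_compact_mem_nhds (π (γ z))
  obtain ⟨t, ht⟩ := isCompact_univ.elim_finite_subcover
    (fun z => r '' (s ⁻¹' U ∩ π ⁻¹' interior (C z)))
    (fun z => isLocalHomeomorph_r.isOpenMap _ ((hU.preimage continuous_s).inter
      (isOpen_interior.preimage hπ.isQuotientMap.continuous)))
    (fun z _ => Set.mem_iUnion.2 ⟨z, γ z, ⟨hs z, mem_interior_iff_mem_nhds.2 (hmem z)⟩, hr z⟩)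
  refine ⟨⋃ z ∈ t, C z, t.isCompact_biUnion fun z _ => hC z, fun z => ?_⟩
  obtain ⟨z', hz', g, ⟨h1, h2⟩, h3⟩ := Set.mem_iUnion₂.1 (ht (Set.mem_univ z))
  exact ⟨g, h3, h1, Set.mem_iUnion₂.2 ⟨z', hz', interior_subset h2⟩⟩

/-- Were the image of `C` nowhere dense, some non-empty open set of units of `H` could not be
reached from it by arrows of a fixed compact set. But by minimality every unit of `G` is reached
from `interior C` by an arrow whose image lies in such a set. -/
theorem nonempty_interior_image [T2Space H] [CompactSpace (unitSpace (G := G))]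
    [LocallyCompactSpace H] (hπ : IsQuotientHom π) (hG : IsMinimal G)
    {C : Set (unitSpace (G := G))} (hC : IsCompact C) (hCi : (interior C).Nonempty) :
    (interior (hπ.unitMap '' C)).Nonempty := by
  by_contra hem
  obtain ⟨K, hK, hcov⟩ := hπ.exists_isCompact_arrows hG isOpen_interior hCi
  obtain ⟨x, -⟩ := id hCi
  obtain ⟨V, -, -, ⟨y, hy⟩, hV⟩ := exists_isOpen_subset_of_interior_eq_empty
    (hC.image hπ.continuous_unitMap).isClosed (Set.not_nonempty_iff_eq_empty.1 hem) hK isOpen_univ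
    ⟨hπ.unitMap x, Set.mem_univ _⟩
  obtain ⟨z, rfl⟩ := hπ.surjective_unitMap y
  obtain ⟨g, rfl, hg, hgK⟩ := hcov z
  exact hV _ hgK (by rwa [hπ.r_map]) ⟨s g, interior_subset hg, (hπ.s_map g).symm⟩

/-- Essential principality lifts along a fibrewise injective quotient homomorphism defined on a
minimal groupoid. -/
theorem isEssentiallyPrincipal [T2Space G] [T2Space H] [CompactSpace (unitSpace (G := G))]
    [LocallyCompactSpace H] (hπ : IsQuotientHom π) (hG : IsMinimal G)
    (hinj : ∀ x : unitSpace (G := G), Set.InjOn π {g : G | s g = x})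
    (hH : IsEssentiallyPrincipal H) : IsEssentiallyPrincipal G := by
  rw [IsEssentiallyPrincipal, Set.eq_empty_iff_forall_notMem]
  intro g₀ hg₀
  have hg₀u : π g₀ ∉ unitSpace (G := H) := fun h =>
    (interior_subset hg₀).1 (hπ.mem_unitSpace_of_map hinj h)
  obtain ⟨O, hO, hgO, hOinj⟩ := (isLocalHomeomorph_s (G := H)).isLocallyInjective (π g₀)
  have hS : IsOpen (O ∩ (unitSpace (G := H))ᶜ) := hO.inter isClosed_unitSpace.isOpen_compl
  obtain ⟨C, hCn, hCW, hC⟩ := local_compact_nhds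
    ((isLocalHomeomorph_s.isOpenMap _ (isOpen_interior.inter
      (hS.preimage hπ.isQuotientMap.continuous))).mem_nhds ⟨g₀, ⟨hg₀, hgO, hg₀u⟩, rfl⟩)
  obtain ⟨y, hy⟩ := hπ.nonempty_interior_image hG hC ⟨_, mem_interior_iff_mem_nhds.2 hCn⟩
  -- The image of an isotropy arrow of `G` is the only arrow of `O` with source `y`. So all
  -- non-units of `O` over this open set are isotropy, against essential principality of `H`.
  have key : ∀ y ∈ interior (hπ.unitMap '' C), ∃ g : G, r g = s g ∧
      π g ∈ O ∩ (unitSpace (G := H))ᶜ ∧ s (π g) = y := by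
    intro y hy
    obtain ⟨x, hx, rfl⟩ := interior_subset hy
    obtain ⟨g, ⟨h1, h2⟩, rfl⟩ := hCW hx
    exact ⟨g, (interior_subset h1).2, h2, hπ.s_map g⟩
  have hsub := interior_maximal (s := {h : H | h ∉ unitSpace (G := H) ∧ r h = s h})
    (t := O ∩ (unitSpace (G := H))ᶜ ∩ s ⁻¹' interior (hπ.unitMap '' C))
    (fun h hh => ⟨hh.1.2, by
      obtain ⟨g, h1, h2, h3⟩ := key _ hh.2
      have : π g = h := hOinj h2.1 hh.1.1 h3
      rw [← this, hπ.r_map, hπ.s_map, h1]⟩)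
    (hS.inter (isOpen_interior.preimage continuous_s))
  rw [hH] at hsub
  obtain ⟨g, -, h2, rfl⟩ := key y hy
  exact hsub ⟨h2, hy⟩

end IsQuotientHom

end Quotient

/-! ### Compression to vectors supported over a small open set -/

section Compression

theorem hasSum_norm_sq {ι : Type*} (ξ : lp (fun _ : ι => ℂ) 2) :
    HasSum (fun i => ‖ξ i‖ ^ 2) (‖ξ‖ ^ 2) := by
  simpa using lp.hasSum_norm (p := 2) (by norm_num) ξ

variable {G : Type*} [TopologicalSpace G] [EtaleGroupoid G]

/-- If `f` vanishes on the non-units connecting points of `V`, then on vectors supported over `V`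
the operator `λ(f)` is multiplication by the restriction of `f` to the units. -/
theorem le_re_inner_leftRegular (f : C_c(G, ℂ)) {V : Set (unitSpace (G := G))} {c : ℝ}
    (hf : ∀ g ∉ unitSpace (G := G), r g ∈ V → s g ∈ V → f g = 0)
    (hc : ∀ x ∈ V, c ≤ (f x).re) (ξ : lp (fun _ : G => ℂ) 2) (hξ : ∀ g, r g ∉ V → ξ g = 0) :
    c * ‖ξ‖ ^ 2 ≤ (inner ℂ ξ (leftRegular f ξ)).re := by
  refine hasSum_le (fun g => ?_) ((hasSum_norm_sq ξ).mul_left c)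
    (Complex.hasSum_re (lp.hasSum_inner ξ (leftRegular f ξ)))
  by_cases hg : r g ∈ V
  · have h1 : leftRegular f ξ g = f (r g) * ξ g := by
      rw [leftRegular_apply, finsum_eq_single _ g]
      · rw [kernel_of_eq _ rfl, ArrowGroupoid.mul_inv]
      · intro h hne
        by_cases e : s g = s h
        · by_cases hh : r h ∈ V
          · rw [kernel_of_eq _ e, hf _ (fun hu => hne (eq_of_mul_inv_mem_unitSpace e hu).symm)
              (by rwa [r_mul_inv e]) (by rwa [s_mul_inv e]), zero_mul]
          · rw [hξ h hh, mul_zero]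
        · rw [kernel_of_ne _ e, zero_mul]
    have h2 : (inner ℂ (ξ g) (leftRegular f ξ g)).re = (f (r g)).re * ‖ξ g‖ ^ 2 := by
      rw [h1, RCLike.inner_apply, mul_assoc, Complex.mul_conj, Complex.re_mul_ofReal,
        Complex.normSq_eq_norm_sq]
    rw [h2]
    exact mul_le_mul_of_nonneg_right (hc _ hg) (by positivity)
  · simp [hξ g hg]

end Compression

/-! ### Pullback of functions and decomposition over source fibres -/

section Pullback

variable {G H : Type*} [TopologicalSpace G] [EtaleGroupoid G]
  [TopologicalSpace H] [EtaleGroupoid H] {π : G → H}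

/-- The pullback of a compactly supported function along a proper map. -/
noncomputable def pullback {G H : Type*} [TopologicalSpace G] [T2Space G] [TopologicalSpace H] {π : G → H}
    (hπ : IsProperMap π) (f : C_c(H, ℂ)) : C_c(G, ℂ) where
  toFun g := f (π g)
  continuous_toFun := f.continuous.comp hπ.continuous
  hasCompactSupport' := HasCompactSupport.intro (hπ.isCompact_preimage f.hasCompactSupport)
    fun _ hx => image_eq_zero_of_notMem_tsupport hx

theorem pullback_apply {G H : Type*} [TopologicalSpace G] [T2Space G] [TopologicalSpace H]
    {π : G → H} (hπ : IsProperMap π) (f : C_c(H, ℂ)) (g : G) : pullback hπ f g = f (π g) := rfl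

theorem kernel_pullback [T2Space G] (hπ : IsQuotientHom π) (hprop : IsProperMap π)
    (f : C_c(H, ℂ)) {g g' : G} (e : s g = s g') :
    kernel (pullback hprop f) g g' = kernel f (π g) (π g') := by
  rw [kernel_of_eq _ e, kernel_of_eq _ (by rw [hπ.s_map, hπ.s_map, e]), pullback_apply,
    hπ.map_mul _ _ (e.trans (r_inv g').symm), hπ.map_inv]

open Classical in
/-- The restriction of a function on `G` to the fibre of the source map over `x`, transported to
`H` along a fibrewise bijective `π`. -/
noncomputable def fibreFun (π : G → H) (x : unitSpace (G := G)) (ξ : G → ℂ) (h : H) : ℂ :=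
  if hg : ∃ g, s g = x ∧ π g = h then ξ hg.choose else 0

/-- `π` restricts to a bijection between the fibres `Gx` and `Hπ(x)` of the source maps. -/
def IsQuotientHom.IsFibrewiseBijective (hπ : IsQuotientHom π) : Prop :=
  ∀ x : unitSpace (G := G), Set.BijOn π {g : G | s g = x} {h : H | s h = hπ.unitMap x}

theorem fibreFun_map (hπ : IsQuotientHom π) (hfib : hπ.IsFibrewiseBijective)
    {x : unitSpace (G := G)} (ξ : G → ℂ) {g : G} (hg : s g = x) :
    fibreFun π x ξ (π g) = ξ g := by
  have h1 : ∃ a, s a = x ∧ π a = π g := ⟨g, hg, rfl⟩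
  rw [fibreFun, dif_pos h1, (hfib x).injOn h1.choose_spec.1 hg h1.choose_spec.2]

theorem fibreFun_eq_zero (hπ : IsQuotientHom π) (hfib : hπ.IsFibrewiseBijective)
    {x : unitSpace (G := G)} (ξ : G → ℂ) {h : H} (hh : s h ≠ hπ.unitMap x) :
    fibreFun π x ξ h = 0 := by
  refine dif_neg ?_
  rintro ⟨g, hg, rfl⟩
  exact hh ((hfib x).mapsTo hg)

theorem hasSum_fibreFun (hπ : IsQuotientHom π) (hfib : hπ.IsFibrewiseBijective)
    (x : unitSpace (G := G)) (ξ : lp (fun _ : G => ℂ) 2) :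
    HasSum (fun h => ‖fibreFun π x ξ h‖ ^ 2) (∑' g : {g : G | s g = x}, ‖ξ g‖ ^ 2) := by
  rw [← hasSum_subtype_iff_of_support_subset (s := {h : H | s h = hπ.unitMap x}),
    ← (hfib x).equiv.hasSum_iff]
  · have : ((fun h => ‖fibreFun π x ξ h‖ ^ 2) ∘ Subtype.val) ∘ (hfib x).equiv
        = fun g : {g : G | s g = x} => ‖ξ g‖ ^ 2 := by
      funext g
      exact congrArg (‖·‖ ^ 2) (fibreFun_map hπ hfib ξ g.2)
    rw [this]
    exact ((hasSum_norm_sq ξ).summable.subtype _).hasSum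
  · intro h hh
    by_contra hne
    exact hh (by simp [fibreFun_eq_zero hπ hfib ξ hne])

/-- The operator `ℓ²(G) → ℓ²(Gx) ≅ ℓ²(Hπ(x)) ⊆ ℓ²(H)`. -/
noncomputable def fibreMap (hπ : IsQuotientHom π) (hfib : hπ.IsFibrewiseBijective)
    (x : unitSpace (G := G)) (ξ : lp (fun _ : G => ℂ) 2) :
    lp (fun _ : H => ℂ) 2 :=
  ⟨fibreFun π x ξ, memℓp_gen (by simpa using (hasSum_fibreFun hπ hfib x ξ).summable)⟩

/-- The source fibres partition `G`, so the maps `fibreMap` are jointly isometric; this is what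
makes a bound on `ℓ²(H)` summable to one on `ℓ²(G)`. -/
theorem hasSum_norm_sq_fibreMap (hπ : IsQuotientHom π) (hfib : hπ.IsFibrewiseBijective)
    (ξ : lp (fun _ : G => ℂ) 2) :
    HasSum (fun x => ‖fibreMap hπ hfib x ξ‖ ^ 2) (‖ξ‖ ^ 2) := by
  have h1 : ∀ x, ∑' g : {g : G | s g = x}, ‖ξ g‖ ^ 2 = ‖fibreMap hπ hfib x ξ‖ ^ 2 := fun x =>
    (hasSum_fibreFun hπ hfib x ξ).unique (hasSum_norm_sq (fibreMap hπ hfib x ξ))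
  have h2 := (Equiv.sigmaFiberEquiv (s : G → unitSpace (G := G))).hasSum_iff.2 (hasSum_norm_sq ξ)
  refine h2.sigma fun x => ?_
  rw [← h1]
  exact ((hasSum_norm_sq ξ).summable.subtype _).hasSum

/-- Kernels only couple arrows with equal source, and within a fibre `π` is a bijection matching the
two kernels, so the convolution sums agree term by term. -/
theorem fibreMap_leftRegular (hπ : IsQuotientHom π) (hfib : hπ.IsFibrewiseBijective)
    [T2Space G] (hprop : IsProperMap π) (f : C_c(H, ℂ))
    (x : unitSpace (G := G)) (ξ : lp (fun _ : G => ℂ) 2) :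
    fibreMap hπ hfib x (leftRegular (pullback hprop f) ξ)
      = leftRegular f (fibreMap hπ hfib x ξ) := by
  have hout : ∀ (η : lp (fun _ : G => ℂ) 2) (h : H), s h ≠ hπ.unitMap x →
      fibreMap hπ hfib x η h = 0 := fun η h hne =>
    fibreFun_eq_zero hπ hfib η hne
  ext h
  by_cases hh : s h = hπ.unitMap x
  · obtain ⟨g, hg, rfl⟩ := (hfib x).surjOn hh
    have hg : s g = x := hg
    refine (fibreFun_map hπ hfib _ hg).trans ?_
    have h1 : ∑ᶠ g', kernel (pullback hprop f) g g' * ξ g'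
        = ∑ᶠ g' ∈ {g' : G | s g' = x}, kernel (pullback hprop f) g g' * ξ g' := by
      rw [finsum_mem_def, Set.indicator_eq_self.2]
      intro g' hg'
      by_contra hne
      exact hg' (mul_eq_zero_of_left (kernel_of_ne _ fun e => hne (e.symm.trans hg)) _)
    have h2 : ∑ᶠ h', kernel f (π g) h' * fibreMap hπ hfib x ξ h'
        = ∑ᶠ h' ∈ {h' : H | s h' = hπ.unitMap x}, kernel f (π g) h' * fibreMap hπ hfib x ξ h' := by
      rw [finsum_mem_def, Set.indicator_eq_self.2]
      intro h' hh'
      by_contra hne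
      exact hh' (mul_eq_zero_of_right _ (hout _ _ hne))
    rw [leftRegular_apply, leftRegular_apply, h1, h2]
    refine finsum_mem_eq_of_bijOn π (hfib x) fun g' hg' => ?_
    rw [kernel_pullback hπ hprop f (hg.trans (Eq.symm hg'))]
    exact congrArg _ (fibreFun_map hπ hfib ξ hg').symm
  · rw [hout _ _ hh, leftRegular_apply]
    refine (finsum_eq_zero_of_forall_eq_zero fun h' => ?_).symm
    by_cases e : s h = s h'
    · rw [hout _ _ (e ▸ hh), mul_zero]
    · rw [kernel_of_ne _ e, zero_mul]

/-- A lower bound for `λ(f) λ(g)` on `ℓ²(H)` passes to the pullbacks on `ℓ²(G)`. -/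
theorem mul_norm_sq_le_norm_sq_pullback (hπ : IsQuotientHom π) (hfib : hπ.IsFibrewiseBijective)
    [T2Space G] (hprop : IsProperMap π) {c : ℝ}
    (f g : C_c(H, ℂ)) (hc : ∀ η, c * ‖η‖ ^ 2 ≤ ‖leftRegular f (leftRegular g η)‖ ^ 2)
    (ξ : lp (fun _ : G => ℂ) 2) :
    c * ‖ξ‖ ^ 2 ≤ ‖leftRegular (pullback hprop f) (leftRegular (pullback hprop g) ξ)‖ ^ 2 := by
  refine hasSum_le (fun x => ?_) ((hasSum_norm_sq_fibreMap hπ hfib ξ).mul_left c)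
    (hasSum_norm_sq_fibreMap hπ hfib _)
  rw [fibreMap_leftRegular, fibreMap_leftRegular]
  exact hc _

end Pullback

end EtaleGroupoid

/-! ### From lower bounds to invertibility -/

/-- The element `z` is the inverse square root of the strictly positive element `star q * q`. -/
theorem exists_conjugate_eq_one_of_isUnit {A : Type*} [CStarAlgebra A] {q : A}
    (hq : IsUnit (star q * q)) : ∃ z : A, z * (star q * q) * star z = 1 := by
  let _ := CStarAlgebra.spectralOrder A
  have := CStarAlgebra.spectralOrderedRing A
  have hpos : IsStrictlyPositive (star q * q) :=
    hq.isStrictlyPositive (star_mul_self_nonneg q)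
  refine ⟨(star q * q) ^ (-(1 / 2) : ℝ), ?_⟩
  have hsa : star ((star q * q) ^ (-(1 / 2) : ℝ)) = (star q * q) ^ (-(1 / 2) : ℝ) :=
    IsSelfAdjoint.of_nonneg CFC.rpow_nonneg
  rw [hsa]
  exact CFC.conjugate_rpow_neg_one_half _ hpos

theorem norm_apply_sq_eq_re_inner {E : Type*} [NormedAddCommGroup E] [InnerProductSpace ℂ E]
    [CompleteSpace E] (T : E →L[ℂ] E) (ξ : E) : ‖T ξ‖ ^ 2 = (inner ℂ ξ ((star T * T) ξ)).re := by
  change _ = (inner ℂ ξ (star T (T ξ))).re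
  rw [ContinuousLinearMap.star_eq_adjoint, ContinuousLinearMap.adjoint_inner_right,
    inner_self_eq_norm_sq_to_K]
  norm_cast

/-- The lower bound for `T` says that the quadratic form of `star T * T` is coercive. -/
theorem isUnit_star_mul_self_of_le {E : Type*} [NormedAddCommGroup E] [InnerProductSpace ℂ E]
    [CompleteSpace E] (T : E →L[ℂ] E) {c : ℝ} (hc : 0 < c) (h : ∀ ξ, c * ‖ξ‖ ^ 2 ≤ ‖T ξ‖ ^ 2) :
    IsUnit (star T * T) := by
  refine ContinuousLinearMap.isUnit_of_forall_le_norm_inner_map _ (c := ⟨c, hc.le⟩) hc fun ξ => ?_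
  rw [norm_inner_symm]
  refine le_trans ?_ (Complex.re_le_norm _)
  rw [← norm_apply_sq_eq_re_inner, mul_comm]
  exact h ξ

namespace EtaleGroupoid

open ArrowGroupoid

theorem exists_bump {X : Type*} [TopologicalSpace X] [T2Space X] [LocallyCompactSpace X]
    {K O : Set X} (hK : IsCompact K) (hO : IsOpen O) (hKO : K ⊆ O) :
    ∃ φ : C_c(X, ℂ), (∀ x ∈ K, φ x = 1) ∧ ∀ x ∉ O, φ x = 0 := by
  obtain ⟨f, h1, h0, hc, -⟩ := exists_continuous_one_zero_of_isCompact hK hO.isClosed_compl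
    (Set.disjoint_compl_right_iff_subset.2 hKO)
  refine ⟨⟨⟨fun x => (f x : ℂ), Complex.continuous_ofReal.comp f.continuous⟩,
    hc.comp_left (g := ((↑) : ℝ → ℂ)) Complex.ofReal_zero⟩, fun x hx => ?_, fun x hx => ?_⟩
  · simpa using h1 hx
  · simpa using h0 hx

/-! ### Localizing an element and using pure infiniteness -/

section Localization

variable {G : Type*} [TopologicalSpace G] [T2Space G] [LocallyCompactSpace G] [EtaleGroupoid G]

theorem exists_unit_bump {V : Set (unitSpace (G := G))} (hV : IsOpen V)
    {x : unitSpace (G := G)} (hx : x ∈ V) :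
    ∃ φ : C_c(G, ℂ), φ x = 1 ∧ (∀ g ∉ unitSpace (G := G), φ g = 0) ∧
      ∀ y : unitSpace (G := G), y ∉ V → φ y = 0 := by
  obtain ⟨φ, h1, h0⟩ := exists_bump (isCompact_singleton (x := (x : G)))
    (isOpen_unitSpace.isOpenMap_subtype_val V hV) (by simpa using hx)
  refine ⟨φ, h1 _ rfl, fun g hg => h0 g ?_, fun y hy => h0 y ?_⟩
  · rintro ⟨y, -, rfl⟩
    exact hg y.2
  · rintro ⟨y', hy', e⟩
    exact hy (Subtype.ext e ▸ hy')

variable [CompactSpace (unitSpace (G := G))]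

/-- A non-zero element of the reduced C⋆-algebra of an essentially principal groupoid is bounded
below on the range of some non-zero function on the unit space. -/
theorem exists_le_norm_apply_leftRegular (hG : IsEssentiallyPrincipal G)
    {b : lp (fun _ : G => ℂ) 2 →L[ℂ] lp (fun _ : G => ℂ) 2} (hb : b ∈ reducedCStarAlgebra G)
    (hb0 : b ≠ 0) :
    ∃ (φ : C_c(G, ℂ)) (x : unitSpace (G := G)) (c : ℝ), φ x = 1 ∧
      (∀ g ∉ unitSpace (G := G), φ g = 0) ∧ 0 < c ∧
      ∀ ξ, c * ‖leftRegular φ ξ‖ ^ 2 ≤ ‖b (leftRegular φ ξ)‖ ^ 2 := by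
  classical
  obtain ⟨x₀, hx₀⟩ : ∃ x : unitSpace (G := G), b (lp.single 2 (x : G) 1) ≠ 0 := by
    by_contra! h
    exact hb0 (eq_zero_of_apply_single_unit hb h)
  -- With `star b * b` approximated to within `c`, the real part of `f x₀` is at least `4c - c`,
  -- hence exceeds `2c`; on vectors over `V` the form of `λ(f)` is then at least `2c`, and one more
  -- error `c` leaves the bound `c`.
  set c := ‖b (lp.single 2 (x₀ : G) 1)‖ ^ 2 / 4 with hc
  have hc0 : 0 < c := by positivity
  obtain ⟨f, hf⟩ := exists_norm_sub_leftRegular_lt (mul_mem (star_mem hb) hb) hc0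
  have hdiff : ∀ ξ, |(inner ℂ ξ (leftRegular f ξ)).re - ‖b ξ‖ ^ 2| ≤ c * ‖ξ‖ ^ 2 := by
    intro ξ
    rw [norm_apply_sq_eq_re_inner, abs_sub_comm, ← Complex.sub_re, ← inner_sub_right]
    calc _ ≤ ‖inner ℂ ξ ((star b * b - leftRegular f) ξ)‖ := Complex.abs_re_le_norm _
      _ ≤ ‖ξ‖ * (‖star b * b - leftRegular f‖ * ‖ξ‖) :=
        (norm_inner_le_norm _ _).trans (by gcongr; exact ContinuousLinearMap.le_opNorm _ _)
      _ ≤ ‖ξ‖ * (c * ‖ξ‖) := by gcongr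
      _ = _ := by ring
  have hfx₀ : 2 * c < (f x₀).re := by
    have h1 := hdiff (lp.single 2 (x₀ : G) 1)
    rw [lp.inner_single_left, leftRegular_single, lp.norm_single (by norm_num)] at h1
    have h2 : kernel f (x₀ : G) (x₀ : G) = f x₀ := by
      have := kernel_s f (x₀ : G)
      rwa [s_unit] at this
    rw [h2, show ‖b (lp.single 2 (x₀ : G) 1)‖ ^ 2 = 4 * c by rw [hc]; ring] at h1
    simp only [RCLike.inner_apply, map_one, mul_one, norm_one, one_pow] at h1
    have := (abs_le.1 h1).1
    linarith
  have hcont : Continuous fun x : unitSpace (G := G) => (f x).re :=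
    Complex.continuous_re.comp (f.continuous.comp continuous_subtype_val)
  obtain ⟨V, hVU, hV, ⟨x, hx⟩, hVK⟩ := hG.exists_isOpen_subset
    (K := tsupport f ∩ (unitSpace (G := G))ᶜ)
    (IsCompact.inter_right f.hasCompactSupport isOpen_unitSpace.isClosed_compl)
    (Set.disjoint_left.2 fun g hg => hg.2) (isOpen_lt continuous_const hcont) ⟨x₀, hfx₀⟩
  obtain ⟨φ, hφx, hφ, hφV⟩ := exists_unit_bump hV hx
  refine ⟨φ, x, c, hφx, hφ, hc0, fun ξ => ?_⟩
  have h1 := le_re_inner_leftRegular f (V := V) (c := 2 * c) (fun g hg hr hs => by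
      by_contra hne
      exact hVK g ⟨subset_tsupport f hne, hg⟩ hr hs) (fun y hy => (hVU hy).le)
    (leftRegular φ ξ) (fun g hg => by rw [leftRegular_apply_of_unit φ hφ, hφV _ hg, zero_mul])
  have h2 := (abs_le.1 (hdiff (leftRegular φ ξ))).2
  linarith

/-- In a purely infinite reduced C⋆-algebra, a non-zero function can be composed with another one
to an operator that is bounded below. -/
theorem exists_le_norm_leftRegular_mul (hG : IsPurelyInfinite (reducedCStarAlgebra G))
    {p : C_c(G, ℂ)} (hp : leftRegular p ≠ 0) :
    ∃ v : C_c(G, ℂ), ∀ ξ, 1 / 4 * ‖ξ‖ ^ 2 ≤ ‖leftRegular p (leftRegular v ξ)‖ ^ 2 := by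
  let P : reducedCStarAlgebra G := ⟨leftRegular p, leftRegular_mem p⟩
  have hP : P ≠ 0 := fun h => hp (congrArg Subtype.val h)
  obtain ⟨w, hw⟩ := hG.exists_eq_one (star P * P)
    (fun h => hP ((CStarRing.star_mul_self_eq_zero_iff P).1 h)) ⟨P, rfl⟩
  have hw' : star (leftRegular p * star (w : lp (fun _ : G => ℂ) 2 →L[ℂ] lp (fun _ : G => ℂ) 2))
      * (leftRegular p * star (w : lp (fun _ : G => ℂ) 2 →L[ℂ] lp (fun _ : G => ℂ) 2)) = 1 := by
    rw [star_mul, star_star]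
    have := congrArg Subtype.val hw
    rw [mul_assoc, mul_assoc] at this
    rw [mul_assoc]
    exact this
  have hnorm : ∀ ξ, ‖leftRegular p (star (w : lp (fun _ : G => ℂ) 2 →L[ℂ] lp (fun _ : G => ℂ) 2) ξ)‖
      = ‖ξ‖ := by
    intro ξ
    have h1 := norm_apply_sq_eq_re_inner
      (leftRegular p * star (w : lp (fun _ : G => ℂ) 2 →L[ℂ] lp (fun _ : G => ℂ) 2)) ξ
    rw [hw'] at h1
    have h2 : (inner ℂ ξ ((1 : lp (fun _ : G => ℂ) 2 →L[ℂ] lp (fun _ : G => ℂ) 2) ξ)).re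
        = ‖ξ‖ ^ 2 := by
      change (inner ℂ ξ ξ).re = _
      rw [inner_self_eq_norm_sq_to_K]
      norm_cast
    rw [h2] at h1
    exact (sq_eq_sq₀ (norm_nonneg _) (norm_nonneg _)).1 h1
  -- The operator `λ(p) w⋆` is isometric. Replacing `w⋆` by `λ(v)` at this distance moves its values
  -- by at most half the norm, and squaring the remaining `1/2` gives `1/4`.
  obtain ⟨v, hv⟩ := exists_norm_sub_leftRegular_lt (star_mem w.2)
    (show 0 < 1 / (2 * (‖leftRegular p‖ + 1)) by positivity)
  refine ⟨v, fun ξ => ?_⟩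
  have h1 : ‖leftRegular p ((star (w : lp (fun _ : G => ℂ) 2 →L[ℂ] lp (fun _ : G => ℂ) 2)
      - leftRegular v) ξ)‖ ≤ 1 / 2 * ‖ξ‖ := by
    calc _ ≤ ‖leftRegular p‖ * (1 / (2 * (‖leftRegular p‖ + 1)) * ‖ξ‖) := by
          refine (ContinuousLinearMap.le_opNorm _ _).trans ?_
          gcongr
          refine (ContinuousLinearMap.le_opNorm _ _).trans ?_
          gcongr
      _ = (‖leftRegular p‖ / (‖leftRegular p‖ + 1)) * (1 / 2 * ‖ξ‖) := by
          field_simp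
      _ ≤ 1 * (1 / 2 * ‖ξ‖) := by
          gcongr
          rw [div_le_one (by positivity)]
          linarith
      _ = _ := one_mul _
  have h2 : ‖ξ‖ ≤ ‖leftRegular p ((star (w : lp (fun _ : G => ℂ) 2 →L[ℂ] lp (fun _ : G => ℂ) 2)
      - leftRegular v) ξ)‖ + ‖leftRegular p (leftRegular v ξ)‖ := by
    rw [← hnorm ξ]
    refine le_trans (le_of_eq ?_) (norm_add_le _ _)
    rw [← map_add, _root_.sub_apply, sub_add_cancel]
  have h3 : 1 / 2 * ‖ξ‖ ≤ ‖leftRegular p (leftRegular v ξ)‖ := by linarith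
  calc 1 / 4 * ‖ξ‖ ^ 2 = (1 / 2 * ‖ξ‖) ^ 2 := by ring
    _ ≤ _ := by gcongr

end Localization

/-! ### Assembling a right factor that makes `b` bounded below -/

section Main

variable {G H : Type*} [TopologicalSpace G] [T2Space G] [LocallyCompactSpace G] [EtaleGroupoid G]
  [CompactSpace (unitSpace (G := G))] [TopologicalSpace H] [T2Space H] [LocallyCompactSpace H]
  [EtaleGroupoid H] {π : G → H}

/-- This passes from a bump on `G`, which need not factor through `π`, to one pulled back from `H`,
where the hypothesis on `C⋆_r(H)` applies. It works because `k` spreads `φ` over the whole unit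
space, leaving freedom to localize anywhere in `H`. -/
theorem exists_le_norm_leftRegular_pullback (hπ : IsQuotientHom π)
    (hprop : IsProperMap π) (hfib : hπ.IsFibrewiseBijective) (hG : IsMinimal G)
    (hH : IsEssentiallyPrincipal H) {φ : C_c(G, ℂ)} {x : unitSpace (G := G)} (hφx : φ x = 1)
    (hφ : ∀ g ∉ unitSpace (G := G), φ g = 0) :
    ∃ (k : C_c(G, ℂ)) (p : C_c(H, ℂ)), leftRegular p ≠ 0 ∧
      ∀ ξ, 1 / 4 * ‖leftRegular (pullback hprop p) ξ‖ ^ 2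
        ≤ ‖leftRegular φ (leftRegular k (leftRegular (pullback hprop p) ξ))‖ ^ 2 := by
  classical
  have hcont : Continuous fun x : unitSpace (G := G) => ‖φ x‖ :=
    φ.continuous.norm.comp continuous_subtype_val
  obtain ⟨K, hK, hcov⟩ := hπ.exists_isCompact_arrows hG
    (isOpen_lt (continuous_const (y := (1 / 2 : ℝ))) hcont) ⟨x, by simp [hφx]; norm_num⟩
  -- Inverses are taken because the column at `r g` is evaluated below at `inv g`, whose source is
  -- `r g`; there the entry of `T` is exactly `φ (s g)`.
  obtain ⟨k₀, hk₀, -⟩ := exists_bump (hK.image continuous_inv) isOpen_univ (Set.subset_univ _)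
  let k := pullback hprop k₀
  let T := leftRegular φ * leftRegular k
  have hT : star T * T ∈ leftRegularRange G :=
    mul_mem (star_mem (mul_mem ⟨φ, rfl⟩ ⟨k, rfl⟩)) (mul_mem ⟨φ, rfl⟩ ⟨k, rfl⟩)
  obtain ⟨b, hb⟩ := hT
  have hbre : ∀ z : unitSpace (G := G), 1 / 4 ≤ (b z).re := by
    intro z
    obtain ⟨g, rfl, hgU, hgK⟩ := hcov z
    have h1 := norm_apply_sq_eq_re_inner T (lp.single 2 (r g : G) 1)
    rw [← hb, lp.inner_single_left, leftRegular_single] at h1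
    have h2 : kernel b (r g : G) (r g : G) = b (r g) := by
      have := kernel_s b (r g : G)
      rwa [s_unit] at this
    rw [h2] at h1
    simp only [RCLike.inner_apply, map_one, mul_one] at h1
    rw [← h1]
    have h3 : T (lp.single 2 (r g : G) 1) (inv g) = φ (s g) := by
      change leftRegular φ (leftRegular k (lp.single 2 (r g : G) 1)) (inv g) = _
      rw [leftRegular_apply_of_unit φ hφ, leftRegular_single, r_inv, ← s_inv g, kernel_s]
      have : k (inv g) = 1 := by
        rw [pullback_apply, hπ.map_inv]
        exact hk₀ _ ⟨_, hgK, rfl⟩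
      rw [this, mul_one]
    calc (1 / 4 : ℝ) = (1 / 2) ^ 2 := by norm_num
      _ ≤ ‖T (lp.single 2 (r g : G) 1) (inv g)‖ ^ 2 := by
        rw [h3]
        gcongr
        exact (show (1 / 2 : ℝ) < ‖φ (s g)‖ from hgU).le
      _ ≤ _ := by
        gcongr
        exact lp.norm_apply_le_norm (by norm_num) _ _
  -- The open set is chosen in `H`, against the image of the support of `b`. Non-units of `G` map to
  -- non-units, so over the preimage of `V` the operator `λ(b)` is diagonal.
  obtain ⟨V, -, hV, ⟨y, hy⟩, hVK⟩ := hH.exists_isOpen_subset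
    (K := π '' tsupport b ∩ (unitSpace (G := H))ᶜ)
    (IsCompact.inter_right (IsCompact.image b.hasCompactSupport hprop.continuous)
      isOpen_unitSpace.isClosed_compl)
    (Set.disjoint_left.2 fun g hg => hg.2) isOpen_univ ⟨hπ.unitMap x, Set.mem_univ _⟩
  obtain ⟨p, hpy, hp, hpV⟩ := exists_unit_bump hV hy
  have hpunit : ∀ g ∉ unitSpace (G := G), pullback hprop p g = 0 := fun g hg =>
    hp _ fun h => hg (hπ.mem_unitSpace_of_map (fun x => (hfib x).injOn) h)
  refine ⟨k, p, fun h0 => ?_, fun ξ => ?_⟩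
  · have h1 := leftRegular_single p (y : H) (s (y : H))
    rw [kernel_s, h0, hpy] at h1
    exact zero_ne_one h1
  · have h1 := le_re_inner_leftRegular b (V := hπ.unitMap ⁻¹' V) (c := 1 / 4)
      (fun g hg hr hs => by
        by_contra hne
        refine hVK (π g) ⟨⟨g, subset_tsupport b hne, rfl⟩, fun h =>
          hg (hπ.mem_unitSpace_of_map (fun x => (hfib x).injOn) h)⟩ ?_ ?_
        · rwa [hπ.r_map]
        · rwa [hπ.s_map]) (fun z _ => hbre z) (leftRegular (pullback hprop p) ξ)
      (fun g hg => by
        rw [leftRegular_apply_of_unit _ hpunit]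
        exact mul_eq_zero_of_left (hpV _ hg) _)
    rw [hb, ← norm_apply_sq_eq_re_inner] at h1
    exact h1

theorem exists_mem_le_norm_apply [CompactSpace (unitSpace (G := H))] (hπ : IsQuotientHom π)
    (hprop : IsProperMap π) (hfib : hπ.IsFibrewiseBijective) (hG : IsMinimal G)
    (hH : IsEssentiallyPrincipal H) (hinf : IsPurelyInfinite (reducedCStarAlgebra H))
    {b : lp (fun _ : G => ℂ) 2 →L[ℂ] lp (fun _ : G => ℂ) 2} (hb : b ∈ reducedCStarAlgebra G)
    (hb0 : b ≠ 0) :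
    ∃ y ∈ reducedCStarAlgebra G, ∃ c : ℝ, 0 < c ∧ ∀ ξ, c * ‖ξ‖ ^ 2 ≤ ‖(b * y) ξ‖ ^ 2 := by
  obtain ⟨φ, x, c, hφx, hφ, hc, hle⟩ := exists_le_norm_apply_leftRegular
    (hπ.isEssentiallyPrincipal hG (fun x => (hfib x).injOn) hH) hb hb0
  obtain ⟨k, p, hp, hkp⟩ :=
    exists_le_norm_leftRegular_pullback hπ hprop hfib hG hH hφx hφ
  obtain ⟨v, hv⟩ := exists_le_norm_leftRegular_mul hinf hp
  -- The constant collects `c` from `b` on the range of `λ(φ)`, `1/4` from `φ` and `k`, and `1/4`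
  -- from `p` and `v`.
  refine ⟨leftRegular φ *
      (leftRegular k * (leftRegular (pullback hprop p) * leftRegular (pullback hprop v))),
    mul_mem (leftRegular_mem _) (mul_mem (leftRegular_mem _)
      (mul_mem (leftRegular_mem _) (leftRegular_mem _))), c * (1 / 16), by positivity, fun ξ => ?_⟩
  have h1 := mul_norm_sq_le_norm_sq_pullback hπ hfib hprop p v hv ξ
  have h2 := hkp (leftRegular (pullback hprop v) ξ)
  refine le_trans ?_ (hle (leftRegular k (leftRegular (pullback hprop p)
    (leftRegular (pullback hprop v) ξ))))
  rw [mul_assoc]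
  refine mul_le_mul_of_nonneg_left ?_ hc.le
  linarith

theorem exists_mul_star_eq_one [CompactSpace (unitSpace (G := H))] (hπ : IsQuotientHom π)
    (hprop : IsProperMap π) (hfib : hπ.IsFibrewiseBijective) (hG : IsMinimal G)
    (hH : IsEssentiallyPrincipal H) (hinf : IsPurelyInfinite (reducedCStarAlgebra H))
    {b : reducedCStarAlgebra G} (hb : b ≠ 0) :
    ∃ x : reducedCStarAlgebra G, x * (star b * b) * star x = 1 := by
  obtain ⟨y₀, hy₀, c, hc, hlow⟩ := exists_mem_le_norm_apply hπ hprop hfib hG hH hinf b.2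
    (fun h => hb (Subtype.ext h))
  obtain ⟨y, rfl⟩ : ∃ y : reducedCStarAlgebra G, y = y₀ := ⟨⟨y₀, hy₀⟩, rfl⟩
  have : IsClosed (reducedCStarAlgebra G :
      Set (lp (fun _ : G => ℂ) 2 →L[ℂ] lp (fun _ : G => ℂ) 2)) :=
    StarSubalgebra.isClosed_topologicalClosure _
  -- Spectral permanence: an element of a closed star-subalgebra that is invertible as an operator
  -- has its inverse in the subalgebra.
  have hunit : IsUnit (star (b * y) * (b * y)) :=
    (StarSubalgebra.coe_isUnit (reducedCStarAlgebra G)).1 (isUnit_star_mul_self_of_le _ hc hlow)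
  obtain ⟨z, hz⟩ := exists_conjugate_eq_one_of_isUnit hunit
  refine ⟨z * star y, ?_⟩
  rw [← hz, star_mul, star_mul, star_star]
  simp only [mul_assoc]

end Main

end EtaleGroupoid

theorem mainTheorem6 {G H : Type*}
    [TopologicalSpace G] [T2Space G] [LocallyCompactSpace G] [EtaleGroupoid G]
    [CompactSpace (ArrowGroupoid.unitSpace (G := G))]
    [TopologicalSpace H] [T2Space H] [LocallyCompactSpace H] [EtaleGroupoid H]
    [CompactSpace (ArrowGroupoid.unitSpace (G := H))]
    (hGmin : EtaleGroupoid.IsMinimal G) (hHprin : EtaleGroupoid.IsEssentiallyPrincipal H)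
    (π : G → H) (hπ : EtaleGroupoid.IsQuotientHom π) (hproper : IsProperMap π)
    (hfibre : ∀ x : ArrowGroupoid.unitSpace (G := G),
      Set.BijOn π {g : G | ArrowGroupoid.s g = x}
        {h : H | (ArrowGroupoid.s h : H) = π (x : G)})
    (hH : IsPurelyInfinite (EtaleGroupoid.reducedCStarAlgebra H)) :
    IsPurelyInfinite (EtaleGroupoid.reducedCStarAlgebra G) := by
  have hfib : hπ.IsFibrewiseBijective := fun x => by
    convert hfibre x using 3
    exact Subtype.ext_iff
  have hone : ∀ b : EtaleGroupoid.reducedCStarAlgebra G, b ≠ 0 →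
      ∃ x, x * (star b * b) * star x = 1 := fun b hb =>
    EtaleGroupoid.exists_mul_star_eq_one hπ hproper hfib hGmin hHprin hH hb
  refine ⟨?_, fun I _ => ?_, ?_⟩
  -- Non-vanishing of `C⋆_r(H)` forces `H`, and so `G`, to contain an arrow; its point mass
  -- separates `0` from `1`.
  · have hHne : Nonempty H := by
      by_contra hem
      rw [not_nonempty_iff] at hem
      obtain ⟨a, b, hab⟩ := hH.nontrivial
      refine hab (Subtype.ext (ContinuousLinearMap.ext fun ξ => ?_))
      ext h
      exact hem.elim h
    obtain ⟨h⟩ := hHne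
    obtain ⟨g, -⟩ := hπ.isQuotientMap.surjective h
    classical
    refine ⟨0, 1, fun h01 => ?_⟩
    have h1 := congrArg (fun a : EtaleGroupoid.reducedCStarAlgebra G =>
      (a : lp (fun _ : G => ℂ) 2 →L[ℂ] lp (fun _ : G => ℂ) 2) (lp.single 2 g 1) g) h01
    exact zero_ne_one (h1.trans (lp.single_apply_self (E := fun _ : G => ℂ) 2 g 1))
  · by_cases hI : I = ⊥
    · exact Or.inl hI
    right
    obtain ⟨b, hbI, hb⟩ : ∃ b ∈ I, b ≠ 0 := by
      by_contra! hcon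
      refine hI (le_antisymm (fun b hb => ?_) bot_le)
      rw [hcon b hb]
      exact zero_mem _
    obtain ⟨x, hx⟩ := hone b hb
    have h1 : (1 : EtaleGroupoid.reducedCStarAlgebra G) ∈ I := by
      rw [← hx]
      exact I.mul_mem_right _ _ (I.mul_mem_left _ _ (I.mul_mem_left _ _ hbI))
    refine le_antisymm le_top fun a _ => ?_
    simpa using I.mul_mem_left a 1 h1
  · rintro _ ha ⟨b, rfl⟩
    exact hone b fun h => ha (by rw [h, mul_zero])
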